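/- Let $T$ be a finite tree with at least three vertices; its boundary is the set $\delta\Omega$ of its leaves. A real number $\lambda\ge 0$ is a Steklov eigenvalue of $T$ if there is a function $f\not\equiv 0$ on $V(T)$ with $\sum_{w\sim v}(f(v)-f(w))=0$ at every non-leaf $v$ and $f(\omega)-f(\omega')=\lambda f(\omega)$ at every leaf $\omega$, where $\omega'$ is the unique neighbor of $\omega$. Let $\lambda_2(T)$ be the smallest positive Steklov eigenvalue of $T$. For integers $r\ge1$, $b\ge2$, $c\ge1$ and $0\le t\le b-2$, let $\mathrm{AS}(r,b,c,t)$ (a generalized almost seesaw tree) be the tree obtained by gluing $b$ paths together at one common endpoint, where one path has length $r+1$, one has length $r$, $t$ have length $c+1$, and $b-2-t$ have length $c$. Let $r\ge1$, $D=2r+1$, $n\ge D+1$, $M=n-2r-2$ and $s=\lceil r/2\rceil$. Consider the maximum of $\lambda_2(T)$ over all trees $T$ with $n$ vertices and diameter $D$; uniqueness of a maximizer is always meant up to isomorphism. 1. If $M=0$, the path $P_{D+1}$ on $D+1$ vertices is the unique maximizer. 2. If $M\ge1$, put $q_-=\max\{1,\lfloor M/s\rfloor\}$, $q_+=\lceil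 M/s\rceil$, and write $M=q_\pm c_\pm+t_\pm$ with integers $c_\pm$ and $0\le t_\pm<q_\pm$. Then $\mathrm{AS}(r,q_-+2,c_-,t_-)$ and $\mathrm{AS}(r,q_++2,c_+,t_+)$ have order $n$ and diameter $D$, and $$\max_{|V(T)|=n,\ \operatorname{diam}T=D}\lambda_2(T)=\max\bigl\{\lambda_2(\mathrm{AS}(r,q_-+2,c_-,t_-)),\ \lambda_2(\mathrm{AS}(r,q_++2,c_+,t_+))\bigr\}.$$ Every maximizer is isomorphic to one of these two trees. If the two values on the right differ, then the maximizer is unique (namely the one of the two trees with the larger value). 3. For each fixed $r\ge1$ there is an $N$ such that for every $n\ge N$ the maximizer among trees of order $n$ and diameter $2r+1$ is unique. -/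

import Mathlib

open Classical in
/-- The discrete Laplacian `Δ f (v) = ∑_{w ∼ v} (f v - f w)`. -/
noncomputable def graphLaplacian {V : Type*} [Fintype V] (G : SimpleGraph V) (f : V → ℝ) (v : V) :
    ℝ :=
  ∑ w ∈ Finset.univ.filter (fun w => G.Adj v w), (f v - f w)

/-- A leaf: a vertex with exactly one neighbour. The set of leaves is the boundary. -/
def IsLeafVertex {V : Type*} (G : SimpleGraph V) (v : V) : Prop :=
  ∃! w, G.Adj v w

/-- Steklov eigenvalues of a finite graph with leaf boundary: there is a nontrivial function that is
harmonic at all interior (non-leaf) vertices and whose outward normal derivative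
`f ω - f ω'` (with `ω'` the unique neighbour of the leaf `ω`) equals `lam * f ω` at every leaf. -/
def IsSteklovEigenvalue {V : Type*} [Fintype V] (G : SimpleGraph V) (lam : ℝ) : Prop :=
  0 ≤ lam ∧ ∃ f : V → ℝ, f ≠ 0 ∧
    (∀ v, ¬ IsLeafVertex G v → graphLaplacian G f v = 0) ∧
    (∀ ω ω', IsLeafVertex G ω → G.Adj ω ω' → f ω - f ω' = lam * f ω)

/-- The first nonzero Steklov eigenvalue `λ₂`. The spectrum is a finite set of reals, so the infimum
is a minimum for every tree with at least two leaves that has an interior vertex; and as `0` is a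
simple eigenvalue of a tree, this is also the second eigenvalue counted with multiplicity. -/
noncomputable def steklovLambda2 {V : Type*} [Fintype V] (G : SimpleGraph V) : ℝ :=
  sInf {lam : ℝ | 0 < lam ∧ IsSteklovEigenvalue G lam}

/-- Trees of order `n` and diameter `D`. -/
def IsTreeOfOrderDiam {V : Type*} [Fintype V] (n D : ℕ) (G : SimpleGraph V) : Prop :=
  G.IsTree ∧ Fintype.card V = n ∧ G.diam = D

/-- `G` maximizes `λ₂` among trees of order `n` and diameter `D`. -/
def IsExtremizer {V : Type} [Fintype V] (n D : ℕ) (G : SimpleGraph V) : Prop :=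
  IsTreeOfOrderDiam n D G ∧
    ∀ (W : Type) [Fintype W] (H : SimpleGraph W), IsTreeOfOrderDiam n D H →
      steklovLambda2 H ≤ steklovLambda2 G

/-- `G` is, up to isomorphism, the only maximizer of `λ₂` among trees of order `n` and
diameter `D`. -/
def IsUniqueExtremizer {V : Type} [Fintype V] (n D : ℕ) (G : SimpleGraph V) : Prop :=
  IsExtremizer n D G ∧
    ∀ (W : Type) [Fintype W] (H : SimpleGraph W), IsExtremizer n D H → Nonempty (H ≃g G)

/-- The spider `S(ℓ₁, …, ℓ_b)`. The vertex `none` is the center, and `some ⟨i, j⟩` is the vertex at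
distance `j + 1` from the center on the `i`-th branch, which has `ℓᵢ` edges. -/
def spider (l : List ℕ) : SimpleGraph (Option (Σ i : Fin l.length, Fin (l.get i))) :=
  SimpleGraph.fromRel fun x y =>
    match x, y with
    | none, some ⟨_, j⟩ => (j : ℕ) = 0
    | some ⟨i, j⟩, some ⟨i', j'⟩ => i = i' ∧ (j : ℕ) + 1 = (j' : ℕ)
    | _, _ => False

/-- The branch lengths of `AS(r, b, c, t)`: one of length `r + 1`, one of length `r`, `t` of length
`c + 1`, and `b - 2 - t` of length `c`. -/
abbrev almostSeesawLengths (r b c t : ℕ) : List ℕ :=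
  (r + 1) :: r :: (List.replicate t (c + 1) ++ List.replicate (b - 2 - t) c)

/-- The generalized almost seesaw tree `AS(r, b, c, t)` (for `r ≥ 1`, `b ≥ 2`, `c ≥ 1` and
`0 ≤ t ≤ b - 2`). -/
abbrev almostSeesaw (r b c t : ℕ) := spider (almostSeesawLengths r b c t)

/-!
A tree of diameter `2 * r + 1` consists of two rooted trees of height `r` whose roots are joined by
an edge. Following from each vertex a highest child splits these two trees into descending paths:
one through each root, and others of lengths `k ≤ r`. On a path of length `k` that ends in a leaf, a
solution of the Steklov problem for `lam` is affine, so the path acts on its top end like the linear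
response `lam / (1 - lam * k)`. A test function glued from such solutions, with values of opposite
signs at the two roots, shows `λ₂ ≤ lam` whenever `1 / (r + 1) < lam < 1 / r` and

  `(R r - 1) * (R r - 1 + ∑ R k) ≥ 1`, where `R k = lam / (1 - lam * k)`

and the sum is over the paths through no root; equality forces all these paths to start at the same
root, that is, the tree to be a spider. At `lam = λ₂` of such a spider the left side is `1`. Hence
maximizing `λ₂` amounts to minimizing `∑ R k` subject to `∑ k = M`. Since `R` is convex, the parts
should be as equal as possible, and comparison with the chord of `R` over `[e, e + 1]` tells which
number of parts is better: the value of the chord at `0` is positive for `2 * e + 1 ≤ r` and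
negative for `2 * e ≥ r`, so that parts of size about `r / 2` are best.

For large orders, if the two candidates had the same `λ₂`, then this number would be a root of one
of finitely many quadratic polynomials, which do not depend on the number of branches; but for each
given `lam` the equation `(R r - 1) * (R r - 1 + ∑ R k) = 1` bounds the number of branches.
-/

section Rayleigh

variable {E : Type*} [NormedAddCommGroup E] [NormedSpace ℝ E] [FiniteDimensional ℝ E]
  {A B : LinearMap.BilinForm ℝ E}

/-- The quotient `B x x / (A x x + B x x)`, unlike `A x x / B x x`, is continuous off the origin. -/
theorem exists_forall_mul_le_mul_of_pos_add (hpos : ∀ x, x ≠ 0 → 0 < A x x + B x x)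
    [Nontrivial E] :
    ∃ x, x ≠ 0 ∧ ∀ y, B y y * (A x x + B x x) ≤ B x x * (A y y + B y y) := by
  have continuous_diag : ∀ C : LinearMap.BilinForm ℝ E, Continuous fun x => C x x := fun C => by
    have : Continuous fun x => C.toContinuousBilinearMap x x := by fun_prop
    simpa using this
  obtain ⟨x, hx, hmax⟩ := (isCompact_sphere (0 : E) 1).exists_isMaxOn
    (f := fun x => B x x / (A x x + B x x))
    (NormedSpace.sphere_nonempty.2 zero_le_one)
    ((continuous_diag B).continuousOn.div ((continuous_diag A).add (continuous_diag B)).continuousOn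
      fun x hx => (hpos x (ne_zero_of_mem_unit_sphere ⟨x, hx⟩)).ne')
  have hx0 : x ≠ 0 := ne_zero_of_mem_unit_sphere ⟨x, hx⟩
  refine ⟨x, hx0, fun y => ?_⟩
  rcases eq_or_ne y 0 with rfl | hy
  · simp
  have hle : B y y / (A y y + B y y) ≤ B x x / (A x x + B x x) := by
    have hscaled : B (‖y‖⁻¹ • y) (‖y‖⁻¹ • y) /
        (A (‖y‖⁻¹ • y) (‖y‖⁻¹ • y) + B (‖y‖⁻¹ • y) (‖y‖⁻¹ • y)) = B y y / (A y y + B y y) := by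
      have : ‖y‖⁻¹ ≠ 0 := inv_ne_zero (norm_ne_zero_iff.2 hy)
      simp only [map_smul, LinearMap.smul_apply, smul_eq_mul, ← mul_add]
      rw [mul_div_mul_left _ _ this, mul_div_mul_left _ _ this]
    exact hscaled ▸ hmax (by simp [norm_smul, hy])
  rwa [div_le_div_iff₀ (hpos y hy) (hpos x hx0)] at hle

theorem exists_generalized_eigenvector (hA : A.IsSymm) (hB : B.IsPosSemidef)
    (hpos : ∀ x, x ≠ 0 → 0 < A x x + B x x) {z : E} (hz : 0 < B z z) :
    ∃ (ν : ℝ) (x : E), 0 < B x x ∧ (∀ y, A x y = ν * B x y) ∧ ∀ y, ν * B y y ≤ A y y := by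
  have : Nontrivial E := ⟨z, 0, by rintro rfl; simp at hz⟩
  obtain ⟨x, hx0, hmax⟩ := exists_forall_mul_le_mul_of_pos_add hpos
  have hx : 0 < B x x := by
    refine (hB.nonneg x).lt_of_ne fun h => ?_
    have := hmax z
    rw [← h, zero_mul] at this
    exact this.not_gt (mul_pos hz (h ▸ hpos x hx0))
  have hmin : ∀ y, A x x / B x x * B y y ≤ A y y := fun y => by
    rw [div_mul_eq_mul_div, div_le_iff₀ hx]
    linarith [hmax y]
  refine ⟨A x x / B x x, x, hx, fun y => ?_, hmin⟩
  set C := A - (A x x / B x x) • B with hC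
  have hC0 : ∀ y, 0 ≤ C y y := fun y => by simpa [hC] using hmin y
  have hCsymm : C.IsSymm := hA.sub (hB.isSymm.smul _)
  have hCx : C x x = 0 := by simp [hC, hx.ne']
  have hCy : C x y = 0 := by
    have := C.apply_sq_le_of_symm hC0 (LinearMap.BilinForm.isSymm_iff.1 hCsymm) x y
    rwa [hCx, zero_mul, sq_nonpos_iff] at this
  simpa [hC, sub_eq_zero] using hCy

end Rayleigh

section Variational

open Finset Classical

variable {V : Type*} [Fintype V] {G : SimpleGraph V}

/-- The boundary of `G`: its leaves. -/
noncomputable def leaves (G : SimpleGraph V) : Finset V := univ.filter (IsLeafVertex G)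

theorem mem_leaves {v : V} : v ∈ leaves G ↔ IsLeafVertex G v := by simp [leaves]

/-- The Dirichlet form `∑_{v ∼ w} (f v - f w) (g v - g w)`, each edge being counted once. -/
noncomputable def dirichletForm (G : SimpleGraph V) : LinearMap.BilinForm ℝ (V → ℝ) :=
  Matrix.toLinearMap₂' ℝ (G.lapMatrix ℝ)

/-- The `ℓ²` inner product on the boundary. -/
noncomputable def leafForm (G : SimpleGraph V) : LinearMap.BilinForm ℝ (V → ℝ) :=
  Matrix.toLinearMap₂' ℝ (Matrix.diagonal fun v => if v ∈ leaves G then 1 else 0)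

/-- The pairs `(lam, f)` of the Steklov problem, `f = 0` included. -/
def IsSteklovPair (G : SimpleGraph V) (lam : ℝ) (f : V → ℝ) : Prop :=
  (∀ v, ¬ IsLeafVertex G v → graphLaplacian G f v = 0) ∧
    ∀ ω ω', IsLeafVertex G ω → G.Adj ω ω' → f ω - f ω' = lam * f ω

theorem graphLaplacian_eq_lapMatrix_mulVec (f : V → ℝ) (v : V) :
    graphLaplacian G f v = (G.lapMatrix ℝ).mulVec f v := by
  rw [SimpleGraph.lapMatrix_mulVec_apply, graphLaplacian, sum_sub_distrib, sum_const,
    nsmul_eq_mul, ← SimpleGraph.card_neighborFinset_eq_degree]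
  congr!
  all_goals ext; simp

theorem graphLaplacian_of_isLeafVertex (f : V → ℝ) {v w : V} (hv : IsLeafVertex G v)
    (hw : G.Adj v w) : graphLaplacian G f v = f v - f w := by
  have : univ.filter (fun w => G.Adj v w) = {w} := by
    ext x
    simpa using ⟨fun h => hv.unique h hw, fun h => h ▸ hw⟩
  rw [graphLaplacian]
  convert sum_singleton (fun w => f v - f w) w

theorem isSymm_toLinearMap₂' {M : Matrix V V ℝ} (hM : M.IsSymm) :
    LinearMap.BilinForm.IsSymm (Matrix.toLinearMap₂' ℝ M) :=
  ⟨fun f g => by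
    rw [Matrix.toLinearMap₂'_apply', Matrix.toLinearMap₂'_apply', Matrix.dotProduct_mulVec,
      dotProduct_comm, ← Matrix.mulVec_transpose, hM]⟩

theorem dirichletForm_isSymm : (dirichletForm G).IsSymm :=
  isSymm_toLinearMap₂' (G.isSymm_lapMatrix ℝ)

theorem leafForm_isSymm : (leafForm G).IsSymm :=
  isSymm_toLinearMap₂' (Matrix.isSymm_diagonal _)

theorem dirichletForm_apply (f g : V → ℝ) :
    dirichletForm G f g = ∑ v, graphLaplacian G f v * g v := by
  rw [dirichletForm_isSymm.eq, dirichletForm, Matrix.toLinearMap₂'_apply']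
  simp_rw [graphLaplacian_eq_lapMatrix_mulVec, dotProduct, mul_comm]

theorem dirichletForm_self (f : V → ℝ) :
    dirichletForm G f f = (∑ v, ∑ w, if G.Adj v w then (f v - f w) ^ 2 else 0) / 2 :=
  SimpleGraph.lapMatrix_toLinearMap₂' ..

theorem leafForm_apply (f g : V → ℝ) : leafForm G f g = ∑ v ∈ leaves G, f v * g v := by
  simp [leafForm, Matrix.toLinearMap₂'_apply', dotProduct, Matrix.mulVec_diagonal]

theorem dirichletForm_self_nonneg (f : V → ℝ) : 0 ≤ dirichletForm G f f := by
  rw [dirichletForm_self]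
  positivity

theorem leafForm_self_nonneg (f : V → ℝ) : 0 ≤ leafForm G f f :=
  leafForm_apply f f ▸ sum_nonneg fun _ _ => mul_self_nonneg _

theorem dirichletForm_one_right (f : V → ℝ) : dirichletForm G f 1 = 0 := by
  rw [dirichletForm, Matrix.toLinearMap₂'_apply']
  have : (G.lapMatrix ℝ).mulVec 1 = 0 := G.lapMatrix_mulVec_const_eq_zero
  rw [this, dotProduct_zero]

theorem eq_of_dirichletForm_self_eq_zero (hG : G.Preconnected) {f : V → ℝ}
    (hf : dirichletForm G f f = 0) (x y : V) : f x = f y :=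
  (G.lapMatrix_toLinearMap₂'_apply'_eq_zero_iff_forall_reachable f).1 hf x y (hG x y)

theorem isSteklovPair_iff_dirichletForm {lam : ℝ} {f : V → ℝ} :
    IsSteklovPair G lam f ↔ ∀ g, dirichletForm G f g = lam * leafForm G f g := by
  have pointwise : IsSteklovPair G lam f ↔
      ∀ v, graphLaplacian G f v = if v ∈ leaves G then lam * f v else 0 := by
    refine ⟨fun h v => ?_, fun h => ⟨fun v hv => ?_, fun ω ω' hω hadj => ?_⟩⟩
    · split_ifs with hv
      · obtain ⟨w, hw, -⟩ := mem_leaves.1 hv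
        rw [graphLaplacian_of_isLeafVertex f (mem_leaves.1 hv) hw, h.2 v w (mem_leaves.1 hv) hw]
      · exact h.1 v (mt mem_leaves.2 hv)
    · rw [h, if_neg (mt mem_leaves.1 hv)]
    · rw [← graphLaplacian_of_isLeafVertex f hω hadj, h, if_pos (mem_leaves.2 hω)]
  rw [pointwise]
  refine ⟨fun h g => ?_, fun h v => ?_⟩
  · simp only [dirichletForm_apply, h, leafForm_apply, mul_sum, ite_mul, zero_mul, sum_ite_mem,
      univ_inter, mul_assoc]
  · simpa [dirichletForm_apply, leafForm_apply, Pi.single_apply] using h (Pi.single v 1)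

theorem dirichletForm_add_leafForm_pos (hG : G.Preconnected) (hl : (leaves G).Nonempty)
    {f : V → ℝ} (hf : f ≠ 0) : 0 < dirichletForm G f f + leafForm G f f := by
  have hD := dirichletForm_self_nonneg (G := G) f
  have hB := leafForm_self_nonneg (G := G) f
  refine (add_nonneg hD hB).lt_of_ne fun h => hf ?_
  obtain ⟨ω, hω⟩ := hl
  have hfω : f ω = 0 := by
    have h0 : leafForm G f f = 0 := by linarith
    rw [leafForm_apply, sum_eq_zero_iff_of_nonneg fun v _ => mul_self_nonneg (f v)] at h0
    simpa using h0 ω hω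
  ext v
  have hfv : f v = f ω := eq_of_dirichletForm_self_eq_zero hG (by linarith) v ω
  rw [hfv, hfω, Pi.zero_apply]

theorem IsSteklovPair.leafForm_one_eq_zero {lam : ℝ} {f : V → ℝ} (h : IsSteklovPair G lam f)
    (hlam : lam ≠ 0) : leafForm G f 1 = 0 := by
  have := isSteklovPair_iff_dirichletForm.1 h 1
  rw [dirichletForm_one_right] at this
  exact (mul_eq_zero.1 this.symm).resolve_left hlam

theorem leafForm_one_one_pos (hl : (leaves G).Nonempty) : 0 < leafForm G 1 1 := by
  simpa [leafForm_apply] using card_pos.2 hl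

theorem exists_leafForm_one_eq_zero_pos (hl : 1 < #(leaves G)) :
    ∃ f : V → ℝ, leafForm G f 1 = 0 ∧ 0 < leafForm G f f := by
  obtain ⟨u, hu, w, hw, huw⟩ := one_lt_card.1 hl
  refine ⟨Pi.single u 1 - Pi.single w 1, ?_, ?_⟩
  · simp [leafForm_apply, Pi.single_apply, hu, hw]
  · rw [leafForm_apply]
    exact sum_pos' (fun v _ => mul_self_nonneg _) ⟨u, hu, by simp [huw]⟩

theorem exists_steklovPair_forall_le (hG : G.Preconnected) (hl : 1 < #(leaves G)) :
    ∃ (ν : ℝ) (f : V → ℝ), 0 < ν ∧ f ≠ 0 ∧ IsSteklovPair G ν f ∧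
      ∀ g, leafForm G g 1 = 0 → ν * leafForm G g g ≤ dirichletForm G g g := by
  have hne : (leaves G).Nonempty := card_pos.1 (by lia)
  set W := LinearMap.ker ((leafForm G).flip 1)
  obtain ⟨z, hz1, hz⟩ := exists_leafForm_one_eq_zero_pos hl
  obtain ⟨ν, ⟨f, hf1 : leafForm G f 1 = 0⟩, hf : 0 < leafForm G f f, heq, hle⟩ :=
    exists_generalized_eigenvector (A := (dirichletForm G).restrict W)
      (B := (leafForm G).restrict W) (dirichletForm_isSymm.restrict W)
      ⟨leafForm_isSymm.restrict W, ⟨fun g => leafForm_self_nonneg g.1⟩⟩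
      (fun g hg => dirichletForm_add_leafForm_pos hG hne (Subtype.coe_ne_coe.2 hg))
      (z := ⟨z, hz1⟩) hz
  have hpair : IsSteklovPair G ν f := by
    refine isSteklovPair_iff_dirichletForm.2 fun g => ?_
    have h := heq ⟨g - (leafForm G g 1 / leafForm G 1 1) • 1, by
      simp [W, (leafForm_one_one_pos hne).ne']⟩
    simpa [dirichletForm_one_right, hf1] using h
  have hf0 : f ≠ 0 := by
    rintro rfl
    simp at hf
  refine ⟨ν, f, ?_, hf0, hpair, fun g hg => hle ⟨g, hg⟩⟩
  have hff := isSteklovPair_iff_dirichletForm.1 hpair f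
  refine lt_of_le_of_ne ?_ ?_
  · exact nonneg_of_mul_nonneg_left (hff ▸ dirichletForm_self_nonneg f) hf
  · rintro rfl
    rw [zero_mul] at hff
    obtain ⟨ω, -⟩ := id hne
    obtain ⟨k, rfl⟩ : ∃ k : ℝ, f = k • 1 :=
      ⟨f ω, by ext v; simpa using eq_of_dirichletForm_self_eq_zero hG hff v ω⟩
    have hk : k = 0 := by simpa [(leafForm_one_one_pos hne).ne'] using hf1
    simp [hk] at hf

theorem isLeast_of_steklovPair_of_forall_le (hG : G.Preconnected) (hl : (leaves G).Nonempty)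
    {ν : ℝ} {f : V → ℝ} (hν : 0 < ν) (hf : f ≠ 0) (hpair : IsSteklovPair G ν f)
    (hle : ∀ g, leafForm G g 1 = 0 → ν * leafForm G g g ≤ dirichletForm G g g) :
    IsLeast {lam | 0 < lam ∧ IsSteklovEigenvalue G lam} ν := by
  refine ⟨⟨hν, hν.le, f, hf, hpair⟩, ?_⟩
  rintro lam ⟨hlam, -, g, hg, hgpair : IsSteklovPair G lam g⟩
  have hgg := isSteklovPair_iff_dirichletForm.1 hgpair g
  have hB : 0 < leafForm G g g := by
    have := dirichletForm_add_leafForm_pos hG hl hg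
    rw [hgg] at this
    nlinarith
  exact le_of_mul_le_mul_right (hgg ▸ hle g (hgpair.leafForm_one_eq_zero hlam.ne')) hB

theorem isLeast_steklovLambda2 (hG : G.Preconnected) (hl : 1 < #(leaves G)) :
    IsLeast {lam | 0 < lam ∧ IsSteklovEigenvalue G lam} (steklovLambda2 G) := by
  obtain ⟨ν, f, hν, hf, hpair, hle⟩ := exists_steklovPair_forall_le hG hl
  have h := isLeast_of_steklovPair_of_forall_le hG (card_pos.1 (by lia)) hν hf hpair hle
  rwa [steklovLambda2, h.csInf_eq]

theorem steklovLambda2_mul_leafForm_le (hG : G.Preconnected) (hl : 1 < #(leaves G)) {g : V → ℝ}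
    (hg : leafForm G g 1 = 0) : steklovLambda2 G * leafForm G g g ≤ dirichletForm G g g := by
  obtain ⟨ν, f, hν, hf, hpair, hle⟩ := exists_steklovPair_forall_le hG hl
  have h := isLeast_of_steklovPair_of_forall_le hG (card_pos.1 (by lia)) hν hf hpair hle
  rw [steklovLambda2, h.csInf_eq]
  exact hle g hg

end Variational

section Iso

variable {V W : Type*} {G : SimpleGraph V} {H : SimpleGraph W}

theorem IsLeafVertex.of_iso (e : G ≃g H) {v : V} (h : IsLeafVertex G v) :
    IsLeafVertex H (e v) := by
  obtain ⟨w, hw, huniq⟩ := h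
  refine ⟨e w, e.map_adj_iff.2 hw, fun y hy => ?_⟩
  rw [← huniq (e.symm y) (by simpa using e.symm.map_adj_iff.2 hy), e.apply_symm_apply]

theorem ediam_le_of_iso (e : G ≃g H) : G.ediam ≤ H.ediam := by
  rw [SimpleGraph.ediam_le_iff]
  intro u v
  refine le_trans ?_ (SimpleGraph.edist_le_ediam (u := e u) (v := e v))
  rcases eq_or_ne (H.edist (e u) (e v)) ⊤ with h | h
  · simp [h]
  obtain ⟨p, hp⟩ := SimpleGraph.exists_walk_of_edist_ne_top h
  simpa [hp] using SimpleGraph.edist_le (p.map e.symm.toHom)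

variable [Fintype V] [Fintype W]

theorem graphLaplacian_iso (e : G ≃g H) (f : W → ℝ) (v : V) :
    graphLaplacian G (f ∘ e) v = graphLaplacian H f (e v) := by
  classical
  simp only [graphLaplacian, Finset.sum_filter]
  rw [← e.toEquiv.sum_comp]
  refine Finset.sum_congr rfl fun w _ => ?_
  change _ = if H.Adj (e v) (e w) then f (e v) - f (e w) else 0
  simp only [e.map_adj_iff, Function.comp_apply]

theorem IsSteklovEigenvalue.of_iso (e : G ≃g H) {lam : ℝ} (h : IsSteklovEigenvalue H lam) :
    IsSteklovEigenvalue G lam := by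
  obtain ⟨hlam, f, hf, hharm, hleaf⟩ := h
  refine ⟨hlam, f ∘ e, fun h => hf ?_, fun v hv => ?_, fun ω ω' hω h => ?_⟩
  · ext w
    simpa using congrFun h (e.symm w)
  · rw [graphLaplacian_iso]
    exact hharm _ fun h => hv (by simpa using h.of_iso e.symm)
  · exact hleaf _ _ (hω.of_iso e) (e.map_adj_iff.2 h)

theorem steklovLambda2_iso (e : G ≃g H) : steklovLambda2 G = steklovLambda2 H :=
  congrArg sInf <| Set.ext fun _ =>
    and_congr_right fun _ => ⟨fun h => h.of_iso e.symm, fun h => h.of_iso e⟩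

theorem IsTreeOfOrderDiam.of_iso (e : G ≃g H) {n D : ℕ} (h : IsTreeOfOrderDiam n D H) :
    IsTreeOfOrderDiam n D G := by
  obtain ⟨htree, hcard, hdiam⟩ := h
  refine ⟨e.isTree_iff.2 htree, (Fintype.card_congr e.toEquiv).trans hcard, ?_⟩
  rw [← hdiam, SimpleGraph.diam, SimpleGraph.diam,
    le_antisymm (ediam_le_of_iso e) (ediam_le_of_iso e.symm)]

end Iso

section Forest

variable {V : Type*} {par : V → V} {d : V → ℕ} {r : ℕ}

/-- The height of `v` in the forest with parent map `par` and depth function `d`: the largest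
number of generations by which a descendant lies below `v`. The condition `k ≤ d w` matters at the
roots only, which `par` fixes. -/
noncomputable def forestHeight (par : V → V) (d : V → ℕ) (v : V) : ℕ :=
  sSup {k | ∃ w, k ≤ d w ∧ par^[k] w = v}

theorem depth_iterate (hroot : ∀ v, d v = 0 → par v = v)
    (hpar : ∀ v, d v ≠ 0 → d (par v) + 1 = d v) (k : ℕ) (v : V) :
    d (par^[k] v) = d v - k := by
  induction k generalizing v with
  | zero => rfl
  | succ k ih =>
    rw [Function.iterate_succ_apply, ih]
    rcases eq_or_ne (d v) 0 with h | h
    · rw [hroot v h]; lia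
    · have := hpar v h; lia

theorem bddAbove_forestHeight (hd : ∀ v, d v ≤ r) (v : V) :
    BddAbove {k | ∃ w, k ≤ d w ∧ par^[k] w = v} :=
  ⟨r, fun _ ⟨w, hk, _⟩ => hk.trans (hd w)⟩

theorem exists_iterate_forestHeight (hd : ∀ v, d v ≤ r) (v : V) :
    ∃ w, forestHeight par d v ≤ d w ∧ par^[forestHeight par d v] w = v :=
  Nat.sSup_mem (s := {k | ∃ w, k ≤ d w ∧ par^[k] w = v}) ⟨0, v, zero_le, rfl⟩
    (bddAbove_forestHeight hd v)

theorem forestHeight_le (hd : ∀ v, d v ≤ r) (v : V) : forestHeight par d v ≤ r :=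
  have ⟨w, hw, _⟩ := exists_iterate_forestHeight hd v
  hw.trans (hd w)

theorem le_forestHeight_iterate (hd : ∀ v, d v ≤ r) {v : V} {k : ℕ} (hk : k ≤ d v) :
    k ≤ forestHeight par d (par^[k] v) :=
  le_csSup (bddAbove_forestHeight hd _) ⟨v, hk, rfl⟩

theorem forestHeight_lt_par (hd : ∀ v, d v ≤ r) (hroot : ∀ v, d v = 0 → par v = v)
    (hpar : ∀ v, d v ≠ 0 → d (par v) + 1 = d v) {v : V} (hv : d v ≠ 0) :
    forestHeight par d v < forestHeight par d (par v) := by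
  obtain ⟨w, hw, hwv⟩ := exists_iterate_forestHeight (par := par) hd v
  have hdw := depth_iterate hroot hpar (forestHeight par d v) w
  rw [hwv] at hdw
  have := le_forestHeight_iterate (par := par) hd (v := w) (k := forestHeight par d v + 1) (by lia)
  rwa [Function.iterate_succ_apply', hwv] at this

theorem exists_par_eq_forestHeight_add_one (hd : ∀ v, d v ≤ r) (hroot : ∀ v, d v = 0 → par v = v)
    (hpar : ∀ v, d v ≠ 0 → d (par v) + 1 = d v) {u : V} (hu : 0 < forestHeight par d u) :
    ∃ w, par w = u ∧ forestHeight par d w + 1 = forestHeight par d u := by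
  obtain ⟨w, hw, hwu⟩ := exists_iterate_forestHeight (par := par) hd u
  obtain ⟨k, hk⟩ := Nat.exists_eq_add_of_lt hu
  rw [zero_add] at hk
  rw [hk, Function.iterate_succ_apply'] at hwu
  have hlow := le_forestHeight_iterate (par := par) hd (v := w) (k := k) (by lia)
  have hup := forestHeight_lt_par hd hroot hpar (v := par^[k] w)
    (by have := depth_iterate hroot hpar k w; lia)
  rw [hwu] at hup
  exact ⟨par^[k] w, hwu, by lia⟩

end Forest

section TreeDist

variable {V : Type*} {G : SimpleGraph V}

theorem exists_adj_dist_add_one_eq (hG : G.Connected) {c v : V} (hv : v ≠ c) :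
    ∃ w, G.Adj v w ∧ G.dist c w + 1 = G.dist c v := by
  obtain ⟨p, hp⟩ := hG.exists_walk_length_eq_dist v c
  cases p with
  | nil => exact absurd rfl hv
  | @cons _ w _ h q =>
    refine ⟨w, h, ?_⟩
    rw [SimpleGraph.Walk.length_cons] at hp
    have hwc := SimpleGraph.dist_le q
    have hvc := hG.dist_triangle (u := v) (v := w) (w := c)
    rw [SimpleGraph.dist_eq_one_iff_adj.2 h] at hvc
    rw [SimpleGraph.dist_comm (u := c), SimpleGraph.dist_comm (u := c)]
    lia

theorem eq_of_adj_of_dist_add_one_eq (hG : G.IsTree) {c v w w' : V} (hw : G.Adj v w)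
    (hdw : G.dist c w + 1 = G.dist c v) (hw' : G.Adj v w') (hdw' : G.dist c w' + 1 = G.dist c v) :
    w = w' := by
  have exists_path : ∀ w, G.Adj v w → G.dist c w + 1 = G.dist c v →
      ∃ p : G.Walk v c, p.IsPath ∧ p.snd = w := by
    intro w h hd
    obtain ⟨q, hq⟩ := hG.connected.exists_walk_length_eq_dist w c
    refine ⟨.cons h q, SimpleGraph.Walk.isPath_of_length_eq_dist _ ?_, by simp⟩
    rw [SimpleGraph.Walk.length_cons, hq, SimpleGraph.dist_comm, hd, SimpleGraph.dist_comm]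
  obtain ⟨p, hp, rfl⟩ := exists_path w hw hdw
  obtain ⟨p', hp', rfl⟩ := exists_path w' hw' hdw'
  rw [(hG.existsUnique_path v c).unique hp hp']

/-- An edge `a c` of a tree is the only edge between its two sides. -/
theorem eq_and_eq_of_adj_of_dist_lt (hG : G.IsTree) {a c x y : V} (hac : G.Adj a c)
    (hxy : G.Adj x y) (hx : G.dist a x < G.dist c x) (hy : G.dist c y < G.dist a y) :
    x = a ∧ y = c := by
  have hconn := hG.connected
  have hax := hG.dist_eq_dist_add_one_of_adj x hac
  have hay := hG.dist_eq_dist_add_one_of_adj y hac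
  have hxya := hG.dist_eq_dist_add_one_of_adj a hxy
  have hxyc := hG.dist_eq_dist_add_one_of_adj c hxy
  rw [SimpleGraph.dist_comm (u := x), SimpleGraph.dist_comm (u := x)] at hax
  rw [SimpleGraph.dist_comm (u := y), SimpleGraph.dist_comm (u := y)] at hay
  rcases eq_or_ne y c with rfl | hyc
  · rw [SimpleGraph.dist_self] at hxyc hay
    exact ⟨(hconn.dist_eq_zero_iff.1 (by lia : G.dist a x = 0)).symm, rfl⟩
  obtain ⟨y', hyy', hy'⟩ := exists_adj_dist_add_one_eq hconn hyc
  have hay' := hG.dist_eq_dist_add_one_of_adj a hyy'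
  have htri := hconn.dist_triangle (u := a) (v := c) (w := y')
  rw [SimpleGraph.dist_eq_one_iff_adj.2 hac] at htri
  obtain rfl := eq_of_adj_of_dist_add_one_eq hG (c := a) hxy.symm (by lia) hyy' (by lia)
  lia

theorem dist_add_one_add_dist_le_dist (hG : G.IsTree) {a c x y : V} (hac : G.Adj a c)
    (hx : G.dist a x < G.dist c x) (hy : G.dist c y < G.dist a y) :
    G.dist a x + 1 + G.dist c y ≤ G.dist x y := by
  obtain ⟨p, hp⟩ := hG.connected.exists_walk_length_eq_dist x y
  rw [← hp]
  clear hp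
  induction p with
  | nil => lia
  | @cons x x' y h q ih =>
    rw [SimpleGraph.Walk.length_cons]
    rcases lt_or_ge (G.dist a x') (G.dist c x') with hx' | hx'
    · have := ih hx' hy
      have := hG.dist_eq_dist_add_one_of_adj a h
      lia
    · have hne := hG.dist_ne_of_adj x' hac
      rw [SimpleGraph.dist_comm, SimpleGraph.dist_comm (u := x')] at hne
      obtain ⟨rfl, rfl⟩ := eq_and_eq_of_adj_of_dist_lt hG hac h hx (by lia)
      have := SimpleGraph.dist_le q
      rw [SimpleGraph.dist_self]
      lia

theorem exists_central_edge (hG : G.Connected) {r : ℕ} {u v : V} (huv : G.dist u v = 2 * r + 1) :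
    ∃ a c, G.Adj a c ∧ G.dist a u = r ∧ G.dist c u = r + 1 ∧ G.dist a v = r + 1 ∧
      G.dist c v = r := by
  obtain ⟨p, hp⟩ := hG.exists_walk_length_eq_dist u v
  have hadj := p.adj_getVert_succ (i := r) (by lia)
  refine ⟨p.getVert r, p.getVert (r + 1), hadj, ?_⟩
  have hua := SimpleGraph.dist_le (p.take r)
  have hcv := SimpleGraph.dist_le (p.drop (r + 1))
  rw [SimpleGraph.Walk.take_length] at hua
  rw [SimpleGraph.Walk.drop_length] at hcv
  have hac := SimpleGraph.dist_eq_one_iff_adj.2 hadj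
  have huav := hG.dist_triangle (u := u) (v := p.getVert r) (w := v)
  have hucv := hG.dist_triangle (u := u) (v := p.getVert (r + 1)) (w := v)
  have huac := hG.dist_triangle (u := u) (v := p.getVert r) (w := p.getVert (r + 1))
  have hacv := hG.dist_triangle (u := p.getVert r) (v := p.getVert (r + 1)) (w := v)
  rw [SimpleGraph.dist_comm (v := u), SimpleGraph.dist_comm (v := u)]
  lia

end TreeDist

section Bicentral

variable {V : Type*} {G : SimpleGraph V} {r : ℕ}

/-- A tree presented as two rooted trees of height `r` whose roots `a` and `c` are joined by an
edge: `par` is the parent map (fixing the roots), `H` the height, `ch` selects a highest child (of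
a vertex with children), and `side` is the tree rooted at `a`. -/
structure BicentralForest (G : SimpleGraph V) (r : ℕ) where
  (a c : V)
  (par ch : V → V)
  (H : V → ℕ)
  (side : V → Prop)
  adj_iff : ∀ x y, G.Adj x y ↔
    (x ≠ y ∧ (par x = y ∨ par y = x)) ∨ (x = a ∧ y = c) ∨ (x = c ∧ y = a)
  par_a : par a = a
  par_c : par c = c
  H_a : H a = r
  H_c : H c = r
  H_le : ∀ v, H v ≤ r
  H_lt : ∀ v, v ≠ a → v ≠ c → H v < H (par v)
  ch_spec : ∀ u, 0 < H u → par (ch u) = u ∧ H (ch u) + 1 = H u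
  side_a : side a
  side_c : ¬ side c
  side_par : ∀ v, side (par v) ↔ side v

/-- The same forest with its two roots exchanged. -/
def BicentralForest.swap (B : BicentralForest G r) : BicentralForest G r where
  a := B.c
  c := B.a
  par := B.par
  ch := B.ch
  H := B.H
  side v := ¬ B.side v
  adj_iff x y := by rw [B.adj_iff]; tauto
  par_a := B.par_c
  par_c := B.par_a
  H_a := B.H_c
  H_c := B.H_a
  H_le := B.H_le
  H_lt v hc ha := B.H_lt v ha hc
  ch_spec := B.ch_spec
  side_a := B.side_c
  side_c := not_not.2 B.side_a
  side_par v := not_congr (B.side_par v)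

open Classical in
/-- The neighbour of `v` in the direction of `c`, and `v` itself if there is none. -/
noncomputable def stepTowards (G : SimpleGraph V) (c v : V) : V :=
  if h : ∃ w, G.Adj v w ∧ G.dist c w + 1 = G.dist c v then h.choose else v

open Classical in
/-- The nearer one of the ends `a` and `c` of an edge. In a tree there are no ties. -/
noncomputable def nearerEnd (G : SimpleGraph V) (a c v : V) : V :=
  if G.dist a v < G.dist c v then a else c

variable {a c v w : V}

theorem stepTowards_self : stepTowards G c c = c :=
  dif_neg (by simp)

theorem adj_stepTowards (hG : G.Connected) (hv : v ≠ c) :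
    G.Adj v (stepTowards G c v) ∧ G.dist c (stepTowards G c v) + 1 = G.dist c v := by
  have h := exists_adj_dist_add_one_eq hG hv
  rw [stepTowards, dif_pos h]
  exact h.choose_spec

theorem stepTowards_eq (hG : G.IsTree) (hw : G.Adj v w) (hdw : G.dist c w + 1 = G.dist c v) :
    stepTowards G c v = w :=
  have hv : v ≠ c := fun h => by simp [h] at hdw
  have ⟨hadj, hdist⟩ := adj_stepTowards hG.connected hv
  eq_of_adj_of_dist_add_one_eq hG hadj hdist hw hdw

theorem nearerEnd_eq_or_eq : nearerEnd G a c v = a ∨ nearerEnd G a c v = c :=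
  ite_eq_or_eq ..

theorem nearerEnd_left (hG : G.Connected) (hac : a ≠ c) : nearerEnd G a c a = a :=
  if_pos <| by simpa using hG.pos_dist_of_ne hac.symm

theorem nearerEnd_right : nearerEnd G a c c = c :=
  if_neg (by simp)

theorem nearerEnd_eq_left_iff (hac : a ≠ c) :
    nearerEnd G a c v = a ↔ G.dist a v < G.dist c v := by
  simp [nearerEnd, hac.symm]

theorem nearerEnd_eq_right_iff (hG : G.IsTree) (hac : G.Adj a c) :
    nearerEnd G a c v = c ↔ G.dist c v < G.dist a v := by
  have hne := hG.dist_ne_of_adj v hac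
  rw [SimpleGraph.dist_comm, SimpleGraph.dist_comm (u := v)] at hne
  rw [nearerEnd, ite_eq_right_iff, iff_false_intro hac.ne]
  lia

theorem nearerEnd_stepTowards (hG : G.IsTree) (hac : G.Adj a c) :
    nearerEnd G a c (stepTowards G (nearerEnd G a c v) v) = nearerEnd G a c v := by
  rcases eq_or_ne v (nearerEnd G a c v) with h | hv
  · rw [← h, stepTowards_self, ← h]
  obtain ⟨hadj, hdist⟩ := adj_stepTowards hG.connected hv
  have ha := hG.dist_eq_dist_add_one_of_adj a hadj
  have hc := hG.dist_eq_dist_add_one_of_adj c hadj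
  rcases nearerEnd_eq_or_eq (G := G) (a := a) (c := c) (v := v) with h | h <;>
    rw [h] at hdist ha hc ⊢
  · rw [nearerEnd_eq_left_iff hac.ne] at h ⊢
    lia
  · rw [nearerEnd_eq_right_iff hG hac] at h ⊢
    lia

theorem adj_iff_stepTowards_nearerEnd (hG : G.IsTree) (hac : G.Adj a c) (x y : V) :
    G.Adj x y ↔ (x ≠ y ∧ (stepTowards G (nearerEnd G a c x) x = y ∨
      stepTowards G (nearerEnd G a c y) y = x)) ∨ (x = a ∧ y = c) ∨ (x = c ∧ y = a) := by
  have adj_of_step : ∀ {x y b}, x ≠ y → stepTowards G b x = y → G.Adj x y := by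
    rintro x y b hxy rfl
    refine (adj_stepTowards hG.connected ?_).1
    rintro rfl
    exact hxy stepTowards_self.symm
  refine ⟨fun h => ?_, ?_⟩
  · by_cases heq : nearerEnd G a c x = nearerEnd G a c y
    · rcases hG.dist_eq_dist_add_one_of_adj (nearerEnd G a c x) h with hd | hd
      · exact .inl ⟨h.ne, .inl (stepTowards_eq hG h hd.symm)⟩
      · exact .inl ⟨h.ne, .inr (heq ▸ stepTowards_eq hG h.symm hd.symm)⟩
    · have hx := nearerEnd_eq_or_eq (G := G) (a := a) (c := c) (v := x)
      have hy := nearerEnd_eq_or_eq (G := G) (a := a) (c := c) (v := y)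
      have := nearerEnd_eq_left_iff (G := G) hac.ne (v := x)
      have := nearerEnd_eq_left_iff (G := G) hac.ne (v := y)
      have := nearerEnd_eq_right_iff hG hac (v := x)
      have := nearerEnd_eq_right_iff hG hac (v := y)
      have := eq_and_eq_of_adj_of_dist_lt hG hac h
      have := eq_and_eq_of_adj_of_dist_lt hG hac h.symm
      grind
  · rintro (⟨h, hx | hy⟩ | ⟨rfl, rfl⟩ | ⟨rfl, rfl⟩)
    exacts [adj_of_step h hx, (adj_of_step h.symm hy).symm, hac, hac.symm]

theorem dist_nearerEnd_le (hG : G.IsTree) (hac : G.Adj a c) {u w : V} (hau : G.dist a u = r)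
    (hcu : G.dist c u = r + 1) (haw : G.dist a w = r + 1) (hcw : G.dist c w = r)
    (hdist : ∀ x y, G.dist x y ≤ 2 * r + 1) (v : V) : G.dist (nearerEnd G a c v) v ≤ r := by
  rcases nearerEnd_eq_or_eq (G := G) (a := a) (c := c) (v := v) with h | h <;> rw [h]
  · have := dist_add_one_add_dist_le_dist hG hac ((nearerEnd_eq_left_iff hac.ne).1 h)
      (show G.dist c w < G.dist a w by lia)
    have := hdist v w
    lia
  · have := dist_add_one_add_dist_le_dist hG hac (show G.dist a u < G.dist c u by lia)
      ((nearerEnd_eq_right_iff hG hac).1 h)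
    have := hdist u v
    lia

theorem exists_bicentralForest (hG : G.IsTree) (hfin : G.ediam ≠ ⊤)
    (hdiam : G.diam = 2 * r + 1) : Nonempty (BicentralForest G r) := by
  have := hG.connected.nonempty
  obtain ⟨u, w, huw⟩ := G.exists_dist_eq_diam
  obtain ⟨a, c, hac, hau, hcu, haw, hcw⟩ := exists_central_edge hG.connected (huw.trans hdiam)
  let par v := stepTowards G (nearerEnd G a c v) v
  let d v := G.dist (nearerEnd G a c v) v
  have hnear : ∀ v, nearerEnd G a c (par v) = nearerEnd G a c v :=
    fun v => nearerEnd_stepTowards hG hac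
  have hd : ∀ v, d v ≤ r := dist_nearerEnd_le hG hac hau hcu haw hcw fun x y =>
    hdiam ▸ SimpleGraph.dist_le_diam hfin
  have hd0 : ∀ v, d v = 0 → v = nearerEnd G a c v := fun v hv =>
    (hG.connected.dist_eq_zero_iff.1 hv).symm
  have hroot : ∀ v, d v = 0 → par v = v := fun v hv => by
    simp only [par]
    rw [← hd0 v hv, stepTowards_self]
  have hpar : ∀ v, d v ≠ 0 → d (par v) + 1 = d v := fun v hv => by
    simp only [d, hnear]
    exact (adj_stepTowards hG.connected fun h => hv (by simp [d, ← h])).2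
  have hnear_iterate : ∀ k v, nearerEnd G a c (par^[k] v) = nearerEnd G a c v := fun k v =>
    (Function.Semiconj.iterate_right (f := nearerEnd G a c) (gb := id) hnear k v).trans (by simp)
  have height_nearerEnd : ∀ v, d v = r →
      forestHeight par d (nearerEnd G a c v) = r := fun v hv => by
    have : par^[r] v = nearerEnd G a c v :=
      (hd0 _ (by rw [depth_iterate hroot hpar]; lia)).trans (hnear_iterate r v)
    exact (forestHeight_le hd _).antisymm (this ▸ le_forestHeight_iterate hd hv.ge)
  have hch : ∀ v, ∃ w, 0 < forestHeight par d v →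
      par w = v ∧ forestHeight par d w + 1 = forestHeight par d v := fun v => by
    by_cases h : 0 < forestHeight par d v
    · exact (exists_par_eq_forestHeight_add_one hd hroot hpar h).imp fun _ h' _ => h'
    · exact ⟨v, fun h' => absurd h' h⟩
  choose ch hch using hch
  have hu : nearerEnd G a c u = a := (nearerEnd_eq_left_iff hac.ne).2 (by lia)
  have hw : nearerEnd G a c w = c := (nearerEnd_eq_right_iff hG hac).2 (by lia)
  have ha := nearerEnd_left hG.connected hac.ne
  have hc : nearerEnd G a c c = c := nearerEnd_right
  exact ⟨⟨a, c, par, ch, forestHeight par d, fun v => nearerEnd G a c v = a,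
    adj_iff_stepTowards_nearerEnd hG hac, hroot a (by simp [d, ha]), hroot c (by simp [d, hc]),
    hu ▸ height_nearerEnd u (by simp [d, hu, hau]), hw ▸ height_nearerEnd w (by simp [d, hw, hcw]),
    forestHeight_le hd, fun v hva hvc => forestHeight_lt_par hd hroot hpar fun h => by
      have := hd0 v h
      grind [nearerEnd_eq_or_eq],
    hch, ha, by simpa [hc] using hac.ne.symm, fun v => by rw [hnear]⟩⟩

end Bicentral

section Response

variable {lam : ℝ} {r k : ℕ}

/-- The flux into the root of a path of length `l` which ends in a leaf, for the function with the
value `1` at the root that satisfies the Steklov condition for `lam` at the leaf. -/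
noncomputable def response (lam : ℝ) (l : ℕ) : ℝ := lam / (1 - lam * l)

/-- The function of `lam` whose value `1` characterises `λ₂` of the spider with branches of lengths
`r + 1`, `r` and the elements of `s`. -/
noncomputable def secular (lam : ℝ) (r : ℕ) (s : Multiset ℕ) : ℝ :=
  (response lam r - 1) * (response lam r - 1 + (s.map (response lam)).sum)

theorem pos_of_one_lt_mul_add_one (h : 1 < lam * (r + 1)) : 0 < lam :=
  pos_of_mul_pos_left (zero_lt_one.trans h) (by positivity)

theorem one_sub_mul_pos (h0 : 0 < lam) (hlam : lam * r < 1) (hk : k ≤ r) : 0 < 1 - lam * k := by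
  have : (k : ℝ) ≤ r := by exact_mod_cast hk
  nlinarith

theorem response_pos (h0 : 0 < lam) (hlam : lam * r < 1) (hk : k ≤ r) : 0 < response lam k :=
  div_pos h0 (one_sub_mul_pos h0 hlam hk)

theorem sum_response_nonneg (h0 : 0 < lam) (hlam : lam * r < 1) {s : Multiset ℕ}
    (hs : ∀ k ∈ s, k ≤ r) : 0 ≤ (s.map (response lam)).sum :=
  Multiset.sum_nonneg fun y hy => by
    obtain ⟨k, hk, rfl⟩ := Multiset.mem_map.1 hy
    exact (response_pos h0 hlam (hs k hk)).le

theorem one_lt_response (hlam : lam * r < 1) (hlam' : 1 < lam * (r + 1)) :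
    1 < response lam r := by
  rw [response, one_lt_div (by linarith)]
  linarith

/-- Here `x` and `y` are the values of a test function at a vertex and at its parent. -/
theorem sub_sq_eq_response_mul_sq_sub {x y : ℝ} (hk : 1 - lam * (k + 1) ≠ 0)
    (hxy : x = y * ((1 - lam * k) / (1 - lam * (k + 1)))) :
    (x - y) ^ 2 = response lam k * x ^ 2 - response lam (k + 1) * y ^ 2 := by
  rw [hxy, response, response]
  push_cast
  field_simp
  ring

end Response

section ParentMap

variable {V : Type*} [Fintype V] {G : SimpleGraph V}

open Finset in
theorem dirichletForm_self_eq_sum_parent {up : V → V}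
    (hadj : ∀ x y, G.Adj x y ↔ x ≠ y ∧ (up x = y ∨ up y = x))
    (hup : ∀ x, up (up x) = x → up x = x) (f : V → ℝ) :
    dirichletForm G f f = ∑ x, (f x - f (up x)) ^ 2 := by
  classical
  have split : ∀ x y, (if G.Adj x y then (f x - f y) ^ 2 else 0) =
      (if up x = y then (f x - f y) ^ 2 else 0) + if up y = x then (f y - f x) ^ 2 else 0 := by
    intro x y
    rw [hadj, sub_sq_comm (f y)]
    rcases eq_or_ne x y with rfl | hxy
    · simp
    have : ¬(up x = y ∧ up y = x) := fun ⟨hx, hy⟩ =>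
      hxy (hx ▸ hup x (by rw [hx, hy])).symm
    by_cases hx : up x = y <;> by_cases hy : up y = x <;> simp_all
  rw [dirichletForm_self]
  simp_rw [split, sum_add_distrib]
  rw [sum_comm (f := fun x y => if up y = x then (f y - f x) ^ 2 else 0)]
  simp

end ParentMap

namespace BicentralForest

open Finset Classical

variable {V : Type*} {G : SimpleGraph V} {r : ℕ} (B : BicentralForest G r) {v w : V}

/-- The two vertices without a parent; `B.par` fixes them. -/
def IsRoot (v : V) : Prop := v = B.a ∨ v = B.c

theorem isRoot_a : B.IsRoot B.a := .inl rfl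

theorem isRoot_c : B.IsRoot B.c := .inr rfl

theorem a_ne_c : B.a ≠ B.c := fun h => B.side_c (h ▸ B.side_a)

theorem IsRoot.par_eq {B : BicentralForest G r} (hv : B.IsRoot v) : B.par v = v := by
  rcases hv with rfl | rfl
  exacts [B.par_a, B.par_c]

theorem IsRoot.H_eq {B : BicentralForest G r} (hv : B.IsRoot v) : B.H v = r := by
  rcases hv with rfl | rfl
  exacts [B.H_a, B.H_c]

theorem H_lt_H_par (hv : ¬ B.IsRoot v) : B.H v < B.H (B.par v) :=
  B.H_lt v (fun h => hv (.inl h)) fun h => hv (.inr h)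

theorem H_lt_of_not_isRoot (hv : ¬ B.IsRoot v) : B.H v < r :=
  (B.H_lt_H_par hv).trans_le (B.H_le _)

theorem par_ne (hv : ¬ B.IsRoot v) : B.par v ≠ v := fun h =>
  (B.H_lt_H_par hv).ne (by rw [h])

theorem par_par_ne (hv : ¬ B.IsRoot v) : B.par (B.par v) ≠ v := by
  intro h
  by_cases hp : B.IsRoot (B.par v)
  · exact B.par_ne hv (hp.par_eq.symm.trans h)
  · have hlt := (B.H_lt_H_par hv).trans (B.H_lt_H_par hp)
    exact hlt.ne (by rw [h])

theorem not_isRoot_ch (hv : 0 < B.H v) : ¬ B.IsRoot (B.ch v) := fun h => by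
  obtain ⟨hpar, hH⟩ := B.ch_spec v hv
  rw [h.par_eq] at hpar
  rw [hpar] at hH
  lia

theorem adj_par (hv : ¬ B.IsRoot v) : G.Adj v (B.par v) :=
  (B.adj_iff _ _).2 (.inl ⟨(B.par_ne hv).symm, .inl rfl⟩)

theorem adj_roots : G.Adj B.a B.c := (B.adj_iff _ _).2 (.inr (.inl ⟨rfl, rfl⟩))

theorem adj_ch (hv : 0 < B.H v) : G.Adj v (B.ch v) := by
  have := B.adj_par (B.not_isRoot_ch hv)
  rw [(B.ch_spec v hv).1] at this
  exact this.symm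

theorem exists_adj_isRoot (hv : B.IsRoot v) : ∃ w, B.IsRoot w ∧ G.Adj v w := by
  rcases hv with rfl | rfl
  exacts [⟨_, B.isRoot_c, B.adj_roots⟩, ⟨_, B.isRoot_a, B.adj_roots.symm⟩]

theorem isLeafVertex_iff (hr : 1 ≤ r) : IsLeafVertex G v ↔ B.H v = 0 := by
  refine ⟨fun hv => ?_, fun hH => ?_⟩
  · by_contra hH
    have hH : 0 < B.H v := Nat.pos_of_ne_zero hH
    by_cases hroot : B.IsRoot v
    · obtain ⟨w, hw, hadj⟩ := B.exists_adj_isRoot hroot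
      exact B.not_isRoot_ch hH (hv.unique (B.adj_ch hH) hadj ▸ hw)
    · refine B.par_par_ne hroot ?_
      rw [← hv.unique (B.adj_ch hH) (B.adj_par hroot), (B.ch_spec v hH).1]
  · have hroot : ¬ B.IsRoot v := fun h => by
      have := h.H_eq
      lia
    refine ⟨B.par v, B.adj_par hroot, fun w hw => ?_⟩
    rcases (B.adj_iff v w).1 hw with ⟨hvw, h | h⟩ | ⟨h, -⟩ | ⟨h, -⟩
    · exact h.symm
    · have := B.H_lt_H_par (v := w) fun hw => hvw (h.symm.trans hw.par_eq)
      rw [h] at this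
      lia
    · exact absurd (.inl h) hroot
    · exact absurd (.inr h) hroot

theorem exists_H_eq_zero (v : V) : ∃ w, B.H w = 0 ∧ (B.side w ↔ B.side v) := by
  induction hk : B.H v generalizing v with
  | zero => exact ⟨v, hk, .rfl⟩
  | succ k ih =>
    obtain ⟨hpar, hH⟩ := B.ch_spec v (by lia)
    obtain ⟨w, hw, hs⟩ := ih (B.ch v) (by lia)
    refine ⟨w, hw, hs.trans ?_⟩
    rw [← B.side_par, hpar]

variable [Fintype V]

/-- The top vertices of the paths, other than those through the roots, in the decomposition of the
forest into descending paths of selected children. -/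
noncomputable def tops : Finset V := univ.filter fun v => ¬ B.IsRoot v ∧ B.ch (B.par v) ≠ v

/-- The lengths of the paths in that decomposition, each extended to the parent of its top
vertex. -/
noncomputable def pathLengths : Multiset ℕ := B.tops.val.map fun v => B.H v + 1

theorem mem_tops : v ∈ B.tops ↔ ¬ B.IsRoot v ∧ B.ch (B.par v) ≠ v := by
  simp [tops]

theorem sum_eq_sum_tops {M : Type*} [AddCommMonoid M] (φ : V → M) :
    ∑ v, φ v = φ B.a + φ B.c + ∑ v ∈ B.tops, φ v + ∑ u with 0 < B.H u, φ (B.ch u) := by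
  have sum_ch : ∑ u with 0 < B.H u, φ (B.ch u) =
      ∑ v with ¬ B.IsRoot v ∧ B.ch (B.par v) = v, φ v := by
    refine sum_nbij' B.ch B.par (fun u hu => ?_) (fun v hv => ?_) (fun u hu => ?_)
      (fun v hv => ?_) fun _ _ => rfl
    all_goals simp only [mem_filter_univ] at *
    · exact ⟨B.not_isRoot_ch hu, by rw [(B.ch_spec u hu).1]⟩
    · exact (Nat.zero_le _).trans_lt (B.H_lt_H_par hv.1)
    · exact (B.ch_spec u hu).1
    · exact hv.2
  have hroots : univ.filter B.IsRoot = {B.a, B.c} := by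
    ext v
    simp [IsRoot]
  rw [sum_ch, ← sum_filter_add_sum_filter_not univ B.IsRoot, hroots, sum_pair B.a_ne_c, add_assoc,
    ← sum_filter_not_add_sum_filter (univ.filter fun v => ¬ B.IsRoot v)
      fun v => B.ch (B.par v) = v, filter_filter, filter_filter, tops]
  simp only [add_assoc, ne_eq]

theorem card_eq : Fintype.card V = 2 * r + 2 + B.pathLengths.sum := by
  have hdecomp := B.sum_eq_sum_tops fun v => B.H v + 1
  have hch : ∑ u with 0 < B.H u, (B.H (B.ch u) + 1) = ∑ u, B.H u := by
    rw [sum_filter]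
    refine sum_congr rfl fun u _ => ?_
    split_ifs with hu
    · exact (B.ch_spec u hu).2
    · lia
  rw [hch, B.H_a, B.H_c, sum_add_distrib, sum_const, card_univ, smul_eq_mul, mul_one] at hdecomp
  change _ = _ + ∑ v ∈ B.tops, (B.H v + 1)
  lia

theorem mem_pathLengths_bounds {k : ℕ} (hk : k ∈ B.pathLengths) : 1 ≤ k ∧ k ≤ r := by
  obtain ⟨v, hv, rfl⟩ := Multiset.mem_map.1 hk
  exact ⟨by lia, B.H_lt_of_not_isRoot (B.mem_tops.1 hv).1⟩

theorem sum_map_pathLengths (φ : ℕ → ℝ) :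
    (B.pathLengths.map φ).sum = ∑ v ∈ B.tops, φ (B.H v + 1) := by
  rw [pathLengths, Multiset.map_map]
  rfl

theorem one_lt_card_leaves (B : BicentralForest G r) (hr : 1 ≤ r) : 1 < #(leaves G) := by
  obtain ⟨u, hu, hus⟩ := B.exists_H_eq_zero B.a
  obtain ⟨w, hw, hws⟩ := B.exists_H_eq_zero B.c
  refine one_lt_card.2 ⟨u, mem_leaves.2 ((B.isLeafVertex_iff hr).2 hu), w,
    mem_leaves.2 ((B.isLeafVertex_iff hr).2 hw), ?_⟩
  rintro rfl
  exact B.side_c (hws.1 (hus.2 B.side_a))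

theorem dirichletForm_self_eq (f : V → ℝ) :
    dirichletForm G f f = (f B.a - f B.c) ^ 2 + ∑ v, (f v - f (B.par v)) ^ 2 := by
  set up : V → V := fun v => if v = B.a then B.c else B.par v
  have up_a : up B.a = B.c := if_pos rfl
  have up_of_ne : ∀ {v}, v ≠ B.a → up v = B.par v := fun h => if_neg h
  have up_c : up B.c = B.c := (up_of_ne B.a_ne_c.symm).trans B.par_c
  have hac := B.a_ne_c
  have hpa := B.par_a
  have := B.par_c
  rw [dirichletForm_self_eq_sum_parent (up := up), ← add_sum_erase _ _ (mem_univ B.a),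
    ← add_sum_erase univ (fun v => (f v - f (B.par v)) ^ 2) (mem_univ B.a), up_a, hpa, sub_self,
    zero_pow two_ne_zero, zero_add, sum_congr rfl fun v hv => by rw [up_of_ne (ne_of_mem_erase hv)]]
  · intro x y
    rw [B.adj_iff]
    grind
  · intro x hx
    have := B.par_par_ne (v := x)
    grind [IsRoot]

end BicentralForest

theorem quadratic_nonpos_of_one_le {q α β : ℝ} (hq : 0 < q) (hα : 0 ≤ α) (hβ : 0 ≤ β)
    (h : 1 ≤ q * (q + (α + β))) (x : ℝ) :
    (x - 1) ^ 2 - (q + 1) * (x ^ 2 + 1) - (α * x ^ 2 + β) ≤ 0 ∧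
      ((x - 1) ^ 2 - (q + 1) * (x ^ 2 + 1) - (α * x ^ 2 + β) = 0 →
        q * (q + (α + β)) = 1 ∧ α * β = 0) := by
  have : q * (q + (α + β)) + α * β = (q + α) * (q + β) := by ring
  have hαβ : 0 ≤ α * β := mul_nonneg hα hβ
  have hsq := sq_nonneg ((q + α) * x + 1)
  have key : (q + α) * ((x - 1) ^ 2 - (q + 1) * (x ^ 2 + 1) - (α * x ^ 2 + β)) =
      1 - (q + α) * (q + β) - ((q + α) * x + 1) ^ 2 := by ring
  refine ⟨?_, fun h0 => ?_⟩
  · by_contra! h0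
    have := mul_pos (show 0 < q + α by linarith) h0
    linarith
  · rw [h0, mul_zero] at key
    constructor <;> linarith

namespace BicentralForest

open Finset Classical

variable {V : Type*} {G : SimpleGraph V} {r : ℕ} (B : BicentralForest G r) {v w : V} {lam x : ℝ}

/-- The function with the value `1` at the two roots whose values on every descending path to a leaf
are proportional to a solution of the Steklov problem for `lam`. -/
noncomputable def profile (lam : ℝ) (v : V) : ℝ :=
  if h : B.IsRoot v then 1
  else profile lam (B.par v) * ((1 - lam * B.H v) / (1 - lam * (B.H v + 1)))
termination_by r - B.H v
decreasing_by
  have := B.H_lt_H_par h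
  have := B.H_lt_of_not_isRoot h
  lia

theorem profile_of_isRoot (hv : B.IsRoot v) : B.profile lam v = 1 := by
  rw [profile, dif_pos hv]

theorem profile_of_not_isRoot (hv : ¬ B.IsRoot v) : B.profile lam v =
    B.profile lam (B.par v) * ((1 - lam * B.H v) / (1 - lam * (B.H v + 1))) := by
  rw [profile, dif_neg hv]

theorem one_sub_mul_H_add_one_pos (h0 : 0 < lam) (hlam : lam * r < 1) (hv : ¬ B.IsRoot v) :
    0 < 1 - lam * (B.H v + 1) := by
  exact_mod_cast one_sub_mul_pos h0 hlam (Nat.succ_le_of_lt (B.H_lt_of_not_isRoot hv))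

theorem one_lt_profile_factor (h0 : 0 < lam) (hlam : lam * r < 1) (hv : ¬ B.IsRoot v) :
    1 < (1 - lam * B.H v) / (1 - lam * (B.H v + 1)) := by
  rw [one_lt_div (B.one_sub_mul_H_add_one_pos h0 hlam hv)]
  linarith

theorem one_le_profile (h0 : 0 < lam) (hlam : lam * r < 1) (v : V) : 1 ≤ B.profile lam v := by
  by_cases hv : B.IsRoot v
  · exact (B.profile_of_isRoot hv).ge
  · rw [B.profile_of_not_isRoot hv]
    exact one_le_mul_of_one_le_of_one_le (one_le_profile h0 hlam _)
      (B.one_lt_profile_factor h0 hlam hv).le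
termination_by r - B.H v
decreasing_by
  have := B.H_lt_H_par hv
  have := B.H_lt_of_not_isRoot hv
  lia

theorem one_lt_profile (h0 : 0 < lam) (hlam : lam * r < 1) (hv : ¬ B.IsRoot v) :
    1 < B.profile lam v := by
  rw [B.profile_of_not_isRoot hv]
  exact one_lt_mul_of_le_of_lt (B.one_le_profile h0 hlam _) (B.one_lt_profile_factor h0 hlam hv)

/-- The test function for `λ₂` with the values `x` and `1` at the two roots. -/
noncomputable def testFunction (lam x : ℝ) (v : V) : ℝ :=
  if B.side v then x * B.profile lam v else B.profile lam v

theorem testFunction_a : B.testFunction lam x B.a = x := by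
  simp [testFunction, B.side_a, B.profile_of_isRoot B.isRoot_a]

theorem testFunction_c : B.testFunction lam x B.c = 1 := by
  simp [testFunction, B.side_c, B.profile_of_isRoot B.isRoot_c]

theorem testFunction_of_not_isRoot (hv : ¬ B.IsRoot v) : B.testFunction lam x v =
    B.testFunction lam x (B.par v) * ((1 - lam * B.H v) / (1 - lam * (B.H v + 1))) := by
  simp only [testFunction, B.side_par, B.profile_of_not_isRoot hv, ite_mul, mul_assoc]

theorem testFunction_sq : B.testFunction lam x v ^ 2 =
    (if B.side v then x ^ 2 else 1) * B.profile lam v ^ 2 := by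
  simp only [testFunction, ite_pow, mul_pow, ite_mul, one_mul]

variable [Fintype V]

theorem sum_leaves_profile_pos (hr : 1 ≤ r) (h0 : 0 < lam) (hlam : lam * r < 1) (v : V) :
    0 < ∑ w ∈ leaves G with (B.side w ↔ B.side v), B.profile lam w := by
  obtain ⟨w, hw, hws⟩ := B.exists_H_eq_zero v
  have hpos := fun w => zero_lt_one.trans_le (B.one_le_profile h0 hlam w)
  refine sum_pos (fun w _ => hpos w) ⟨w, ?_⟩
  exact mem_filter.2 ⟨mem_leaves.2 ((B.isLeafVertex_iff hr).2 hw), hws⟩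

theorem exists_neg_leafForm_testFunction_eq_zero (hr : 1 ≤ r) (h0 : 0 < lam)
    (hlam : lam * r < 1) : ∃ x < 0, leafForm G (B.testFunction lam x) 1 = 0 := by
  have ha := B.sum_leaves_profile_pos hr h0 hlam B.a
  have hc := B.sum_leaves_profile_pos hr h0 hlam B.c
  simp only [B.side_a, iff_true] at ha
  simp only [B.side_c, iff_false] at hc
  refine ⟨-(_ / _), neg_lt_zero.2 (div_pos hc ha), ?_⟩
  simp only [leafForm_apply, Pi.one_apply, mul_one, testFunction, sum_ite, ← mul_sum]
  rw [neg_mul, div_mul_cancel₀ _ ha.ne', neg_add_cancel]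

theorem leafForm_eq_sum_response (hr : 1 ≤ r) (f : V → ℝ) :
    lam * leafForm G f f = ∑ u with ¬ 0 < B.H u, response lam (B.H u) * f u ^ 2 := by
  have hleaves : leaves G = univ.filter fun u => ¬ 0 < B.H u := by
    ext v
    simp [mem_leaves, B.isLeafVertex_iff hr]
  rw [leafForm_apply, hleaves, mul_sum]
  refine sum_congr rfl fun u hu => ?_
  have hH : B.H u = 0 := by simpa using hu
  simp [hH, response, sq]

/-- The responses of the descending paths telescope, so that only their top ends contribute. -/
theorem dirichletForm_sub_mul_leafForm (hr : 1 ≤ r) (h0 : 0 < lam) (hlam : lam * r < 1)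
    {f : V → ℝ} (hf : ∀ v, ¬ B.IsRoot v →
      f v = f (B.par v) * ((1 - lam * B.H v) / (1 - lam * (B.H v + 1)))) :
    dirichletForm G f f - lam * leafForm G f f = (f B.a - f B.c) ^ 2 -
      response lam r * (f B.a ^ 2 + f B.c ^ 2) -
      ∑ v ∈ B.tops, response lam (B.H v + 1) * f (B.par v) ^ 2 := by
  let ψ : V → ℝ := fun v => if B.IsRoot v then response lam r * f v ^ 2 else
    response lam (B.H v + 1) * f (B.par v) ^ 2
  have edge_energy : ∀ v, (f v - f (B.par v)) ^ 2 = response lam (B.H v) * f v ^ 2 - ψ v := by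
    intro v
    by_cases hv : B.IsRoot v
    · simp [ψ, hv, hv.par_eq, hv.H_eq]
    · simp only [ψ, if_neg hv]
      exact sub_sq_eq_response_mul_sq_sub (B.one_sub_mul_H_add_one_pos h0 hlam hv).ne' (hf v hv)
  have sum_ψ : ∑ v, ψ v = response lam r * f B.a ^ 2 + response lam r * f B.c ^ 2 +
      ∑ v ∈ B.tops, response lam (B.H v + 1) * f (B.par v) ^ 2 +
      ∑ u with 0 < B.H u, response lam (B.H u) * f u ^ 2 := by
    rw [B.sum_eq_sum_tops]
    refine congrArg₂ _ (congrArg₂ _ ?_ ?_) ?_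
    · simp [ψ, B.isRoot_a, B.isRoot_c]
    · exact sum_congr rfl fun v hv => if_neg (B.mem_tops.1 hv).1
    · refine sum_congr rfl fun u hu => ?_
      have hu : 0 < B.H u := by simpa using hu
      obtain ⟨hpar, hH⟩ := B.ch_spec u hu
      simp [ψ, B.not_isRoot_ch hu, hpar, hH]
  rw [B.dirichletForm_self_eq, sum_congr rfl fun v _ => edge_energy v, sum_sub_distrib, sum_ψ,
    B.leafForm_eq_sum_response hr,
    ← sum_filter_add_sum_filter_not univ (fun u => 0 < B.H u)
      (fun u => response lam (B.H u) * f u ^ 2)]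
  ring

/-- The total response of the paths whose top vertices satisfy `P`; it is used for the two sides of
the central edge. -/
noncomputable def sideResponse (lam : ℝ) (P : V → Prop) : ℝ :=
  ∑ v ∈ B.tops with P v, response lam (B.H v + 1)

theorem response_top_pos (h0 : 0 < lam) (hlam : lam * r < 1) (hv : v ∈ B.tops) :
    0 < response lam (B.H v + 1) :=
  response_pos h0 hlam (B.H_lt_of_not_isRoot (B.mem_tops.1 hv).1)

theorem sideResponse_nonneg (h0 : 0 < lam) (hlam : lam * r < 1) (P : V → Prop) :
    0 ≤ B.sideResponse lam P :=
  sum_nonneg fun _ hv => (B.response_top_pos h0 hlam (mem_filter.1 hv).1).le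

theorem not_of_sideResponse_eq_zero (h0 : 0 < lam) (hlam : lam * r < 1) {P : V → Prop}
    (h : B.sideResponse lam P = 0) (hv : v ∈ B.tops) : ¬ P v := fun hP =>
  (B.response_top_pos h0 hlam hv).ne' <|
    (sum_eq_zero_iff_of_nonneg
      fun _ hw => (B.response_top_pos h0 hlam (mem_filter.1 hw).1).le).1 h v
      (mem_filter.2 ⟨hv, hP⟩)

theorem secular_pathLengths : secular lam r B.pathLengths = (response lam r - 1) *
    (response lam r - 1 + (B.sideResponse lam B.side +
      B.sideResponse lam fun v => ¬ B.side v)) := by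
  rw [secular, B.sum_map_pathLengths, sideResponse, sideResponse, sum_filter_add_sum_filter_not]

theorem sideResponse_le_sum_testFunction (h0 : 0 < lam) (hlam : lam * r < 1) (hx : x ≠ 0) :
    B.sideResponse lam B.side * x ^ 2 + B.sideResponse lam (fun v => ¬ B.side v) ≤
        ∑ v ∈ B.tops, response lam (B.H v + 1) * B.testFunction lam x (B.par v) ^ 2 ∧
      (B.sideResponse lam B.side * x ^ 2 + B.sideResponse lam (fun v => ¬ B.side v) =
          ∑ v ∈ B.tops, response lam (B.H v + 1) * B.testFunction lam x (B.par v) ^ 2 →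
        ∀ v ∈ B.tops, B.IsRoot (B.par v)) := by
  set y : V → ℝ := fun v => if B.side v then x ^ 2 else 1 with hy
  have hy0 : ∀ v, 0 < y v := fun v => by
    simp only [hy]
    split_ifs <;> positivity
  have hsum : B.sideResponse lam B.side * x ^ 2 + B.sideResponse lam (fun v => ¬ B.side v) =
      ∑ v ∈ B.tops, response lam (B.H v + 1) * y v := by
    simp only [hy, sideResponse, mul_ite, mul_one, sum_ite, sum_mul]
  have hf : ∀ v, B.testFunction lam x (B.par v) ^ 2 = y v * B.profile lam (B.par v) ^ 2 := by
    intro v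
    rw [B.testFunction_sq, B.side_par]
  have hterm : ∀ v ∈ B.tops, response lam (B.H v + 1) * y v ≤
      response lam (B.H v + 1) * B.testFunction lam x (B.par v) ^ 2 := fun v hv => by
    rw [hf]
    exact mul_le_mul_of_nonneg_left (le_mul_of_one_le_right (hy0 v).le
      (one_le_pow₀ (B.one_le_profile h0 hlam _))) (B.response_top_pos h0 hlam hv).le
  rw [hsum]
  refine ⟨sum_le_sum hterm, fun heq v hv => ?_⟩
  by_contra hroot
  have := mul_left_cancel₀ (B.response_top_pos h0 hlam hv).ne'
    ((sum_eq_sum_iff_of_le hterm).1 heq v hv)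
  rw [hf] at this
  exact (lt_mul_of_one_lt_right (hy0 v)
    (one_lt_pow₀ (B.one_lt_profile h0 hlam hroot) two_ne_zero)).ne this

theorem dirichletForm_testFunction_le (hr : 1 ≤ r) (hlam : lam * r < 1)
    (hlam' : 1 < lam * (r + 1)) (hsec : 1 ≤ secular lam r B.pathLengths) (hx : x ≠ 0) :
    dirichletForm G (B.testFunction lam x) (B.testFunction lam x) ≤
        lam * leafForm G (B.testFunction lam x) (B.testFunction lam x) ∧
      (dirichletForm G (B.testFunction lam x) (B.testFunction lam x) =
          lam * leafForm G (B.testFunction lam x) (B.testFunction lam x) →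
        ((∀ v ∈ B.tops, B.par v = B.a) ∨ ∀ v ∈ B.tops, B.par v = B.c) ∧
          secular lam r B.pathLengths = 1) := by
  have h0 := pos_of_one_lt_mul_add_one hlam'
  have henergy := B.dirichletForm_sub_mul_leafForm hr h0 hlam
    fun v hv => B.testFunction_of_not_isRoot (x := x) hv
  rw [B.testFunction_a, B.testFunction_c, one_pow] at henergy
  obtain ⟨htops, htops_eq⟩ := B.sideResponse_le_sum_testFunction h0 hlam hx
  rw [secular_pathLengths] at hsec ⊢
  obtain ⟨hquad, hquad_eq⟩ := quadratic_nonpos_of_one_le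
    (sub_pos.2 (one_lt_response hlam hlam')) (B.sideResponse_nonneg h0 hlam _)
    (B.sideResponse_nonneg h0 hlam _) hsec x
  rw [sub_add_cancel] at hquad hquad_eq
  refine ⟨by linarith, fun heq => ?_⟩
  obtain ⟨hsec_eq, hsides⟩ := hquad_eq (by linarith)
  have hroot := htops_eq (by linarith)
  refine ⟨?_, hsec_eq⟩
  rcases mul_eq_zero.1 hsides with h | h
  · refine .inr fun v hv => (hroot v hv).resolve_left fun hpar => ?_
    refine B.not_of_sideResponse_eq_zero h0 hlam h hv ?_
    rw [← B.side_par, hpar]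
    exact B.side_a
  · refine .inl fun v hv => (hroot v hv).resolve_right fun hpar => ?_
    refine B.not_of_sideResponse_eq_zero h0 hlam h hv ?_
    rw [← B.side_par, hpar]
    exact B.side_c

theorem steklovLambda2_le (hG : G.Preconnected) (hr : 1 ≤ r) (hlam : lam * r < 1)
    (hlam' : 1 < lam * (r + 1)) (hsec : 1 ≤ secular lam r B.pathLengths) :
    steklovLambda2 G ≤ lam ∧ (steklovLambda2 G = lam →
      ((∀ v ∈ B.tops, B.par v = B.a) ∨ ∀ v ∈ B.tops, B.par v = B.c) ∧
        secular lam r B.pathLengths = 1) := by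
  have h0 := pos_of_one_lt_mul_add_one hlam'
  have hleaves := B.one_lt_card_leaves hr
  obtain ⟨x, hx, horth⟩ := B.exists_neg_leafForm_testFunction_eq_zero hr h0 hlam
  obtain ⟨hle, heq⟩ := B.dirichletForm_testFunction_le hr hlam hlam' hsec hx.ne
  set f := B.testFunction lam x with hf
  have hf0 : f ≠ 0 := fun h => by
    have hc := B.testFunction_c (lam := lam) (x := x)
    rw [← hf, h] at hc
    exact zero_ne_one hc
  have hpos : 0 < leafForm G f f := by
    have := dirichletForm_add_leafForm_pos hG (card_pos.1 (by lia)) hf0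
    by_contra! hneg
    nlinarith
  have hmin := steklovLambda2_mul_leafForm_le hG hleaves horth
  exact ⟨le_of_mul_le_mul_right (hmin.trans hle) hpos,
    fun h => heq (hle.antisymm (by rwa [h] at hmin))⟩

end BicentralForest

section Spider

variable {l : List ℕ}

/-- The vertex at distance `k` from the center on the `i`-th branch of a spider. -/
def spiderNode (l : List ℕ) (i : Fin l.length) :
    (k : ℕ) → k ≤ l.get i → Option (Σ i : Fin l.length, Fin (l.get i))
  | 0, _ => none
  | k + 1, h => some ⟨i, ⟨k, h⟩⟩

theorem eq_none_or_spiderNode (x : Option (Σ i : Fin l.length, Fin (l.get i))) :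
    x = none ∨ ∃ i k h, x = spiderNode l i (k + 1) h := by
  rcases x with _ | ⟨i, k, hk⟩
  · exact .inl rfl
  · exact .inr ⟨i, k, hk, rfl⟩

theorem spiderNode_inj {i : Fin l.length} {k k' : ℕ} {h : k ≤ l.get i} {h' : k' ≤ l.get i} :
    spiderNode l i k h = spiderNode l i k' h' ↔ k = k' := by
  cases k <;> cases k' <;> simp [spiderNode]

theorem spiderNode_succ_inj {i i' : Fin l.length} {k k' : ℕ} {h : k + 1 ≤ l.get i}
    {h' : k' ≤ l.get i'} (e : spiderNode l i (k + 1) h = spiderNode l i' k' h') :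
    i = i' ∧ k + 1 = k' := by
  cases k' with
  | zero => simp [spiderNode] at e
  | succ k' =>
    simp only [spiderNode, Option.some.injEq, Sigma.mk.injEq] at e
    obtain ⟨rfl, hk⟩ := e
    exact ⟨rfl, by simpa using hk⟩

theorem spider_adj_iff {x y : Option (Σ i : Fin l.length, Fin (l.get i))} :
    (spider l).Adj x y ↔ ∃ i k, ∃ h : k + 1 ≤ l.get i,
      s(x, y) = s(spiderNode l i (k + 1) h, spiderNode l i k (by lia)) := by
  simp only [Sym2.eq_iff]
  constructor
  · rcases x with _ | ⟨i, j, hj⟩ <;> rcases y with _ | ⟨i', j', hj'⟩ <;>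
      simp only [spider, SimpleGraph.fromRel_adj]
    · simp
    · rintro ⟨-, rfl | h⟩
      exacts [⟨i', 0, hj', .inr ⟨rfl, rfl⟩⟩, h.elim]
    · rintro ⟨-, h | rfl⟩
      exacts [h.elim, ⟨i, 0, hj, .inl ⟨rfl, rfl⟩⟩]
    · rintro ⟨-, ⟨rfl, rfl⟩ | ⟨rfl, rfl⟩⟩
      exacts [⟨i, j + 1, hj', .inr ⟨rfl, rfl⟩⟩, ⟨i', j' + 1, hj, .inl ⟨rfl, rfl⟩⟩]
  · have adj_node : ∀ i k (h : k + 1 ≤ l.get i),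
        (spider l).Adj (spiderNode l i (k + 1) h) (spiderNode l i k (by lia)) := by
      rintro i (_ | k) h
      · exact ⟨by simp [spiderNode], .inr rfl⟩
      · exact ⟨by simp [spiderNode], .inr ⟨rfl, rfl⟩⟩
    rintro ⟨i, k, h, ⟨rfl, rfl⟩ | ⟨rfl, rfl⟩⟩
    exacts [adj_node i k h, (adj_node i k h).symm]

theorem spider_adj_node {i : Fin l.length} {k : ℕ} (h : k + 1 ≤ l.get i) :
    (spider l).Adj (spiderNode l i (k + 1) h) (spiderNode l i k (Nat.le_of_succ_le h)) :=
  spider_adj_iff.2 ⟨i, k, h, rfl⟩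

theorem spider_adj_node_succ {i : Fin l.length} {k : ℕ} (h : k + 1 ≤ l.get i)
    {y : Option (Σ i : Fin l.length, Fin (l.get i))} :
    (spider l).Adj (spiderNode l i (k + 1) h) y ↔
      y = spiderNode l i k (Nat.le_of_succ_le h) ∨ ∃ h', y = spiderNode l i (k + 2) h' := by
  constructor
  · rw [spider_adj_iff]
    rintro ⟨i', k', h', hxy⟩
    rcases Sym2.eq_iff.1 hxy with ⟨hx, rfl⟩ | ⟨hx, rfl⟩
    · obtain ⟨rfl, hk⟩ := spiderNode_succ_inj hx
      obtain rfl : k = k' := by lia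
      exact .inl rfl
    · obtain ⟨rfl, rfl⟩ := spiderNode_succ_inj hx
      exact .inr ⟨h', rfl⟩
  · rintro (rfl | ⟨h', rfl⟩)
    exacts [spider_adj_node h, (spider_adj_node h').symm]

theorem spider_exists_walk {i : Fin l.length} (k m : ℕ) (h : k + m ≤ l.get i) :
    ∃ p : (spider l).Walk (spiderNode l i (k + m) h) (spiderNode l i k (by lia)),
      p.length = m := by
  induction m with
  | zero => exact ⟨.nil, rfl⟩
  | succ m ih =>
    obtain ⟨p, hp⟩ := ih (by lia)
    exact ⟨.cons (spider_adj_node (k := k + m) h) p, by simp [hp]⟩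

theorem spider_dist_node_le {i : Fin l.length} (k m : ℕ) (h : k + m ≤ l.get i) :
    (spider l).dist (spiderNode l i (k + m) h) (spiderNode l i k (by lia)) ≤ m := by
  obtain ⟨p, hp⟩ := spider_exists_walk k m h
  exact (SimpleGraph.dist_le p).trans hp.le

theorem spider_connected (l : List ℕ) : (spider l).Connected := by
  have reachable_none : ∀ x, (spider l).Reachable x none := by
    intro x
    rcases eq_none_or_spiderNode x with rfl | ⟨i, k, h, rfl⟩
    · rfl
    · obtain ⟨p, -⟩ := spider_exists_walk (i := i) 0 (k + 1) (by lia)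
      simpa [spiderNode] using p.reachable
  exact (SimpleGraph.connected_iff_exists_forall_reachable _).2
    ⟨none, fun x => (reachable_none x).symm⟩

theorem isTree_of_forall_adj_parent {V : Type*} [Finite V] {G : SimpleGraph V}
    (hG : G.Connected) (c : V) (par : V → V)
    (h : ∀ x y, G.Adj x y → (x ≠ c ∧ par x = y) ∨ (y ≠ c ∧ par y = x)) : G.IsTree := by
  classical
  have := Fintype.ofFinite V
  rw [SimpleGraph.isTree_iff_connected_and_card]
  refine ⟨hG, le_antisymm ?_ hG.card_vert_le_card_edgeSet_add_one⟩
  have edges_subset :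
      G.edgeSet ⊆ ((Finset.univ.erase c).image fun v => s(v, par v) : Finset (Sym2 V)) := by
    intro e he
    induction e with
    | _ x y =>
      rw [Finset.mem_coe, Finset.mem_image]
      rcases h x y he with ⟨hx, rfl⟩ | ⟨hy, rfl⟩
      · exact ⟨x, by simp [hx], rfl⟩
      · exact ⟨y, by simp [hy], Sym2.eq_swap⟩
  have card_le := (Set.ncard_le_ncard edges_subset (Finset.finite_toSet _)).trans
    (Set.ncard_coe_finset _ |>.trans_le Finset.card_image_le)
  rw [Finset.card_erase_of_mem (Finset.mem_univ c), Finset.card_univ] at card_le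
  have : 0 < Fintype.card V := Fintype.card_pos_iff.2 ⟨c⟩
  rw [Nat.card_coe_set_eq, Nat.card_eq_fintype_card]
  lia

theorem spider_isTree (l : List ℕ) : (spider l).IsTree := by
  refine isTree_of_forall_adj_parent (spider_connected l) none
    (fun x => x.elim none fun ⟨i, j⟩ => spiderNode l i j j.2.le) fun x y hxy => ?_
  obtain ⟨i, k, h, e⟩ := spider_adj_iff.1 hxy
  rcases Sym2.eq_iff.1 e with ⟨rfl, rfl⟩ | ⟨rfl, rfl⟩
  exacts [.inl ⟨by simp [spiderNode], rfl⟩, .inr ⟨by simp [spiderNode], rfl⟩]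

theorem spider_card (l : List ℕ) :
    Fintype.card (Option (Σ i : Fin l.length, Fin (l.get i))) = l.sum + 1 := by
  simp [Fintype.card_option, Fintype.card_sigma]

theorem nonempty_iso_spider {V : Type*} [Fintype V] {G : SimpleGraph V} (hG : G.IsTree)
    (hcard : Fintype.card V = l.sum + 1)
    {φ : Option (Σ i : Fin l.length, Fin (l.get i)) → V} (hφ : Function.Surjective φ)
    (hadj : ∀ i k (h : k + 1 ≤ l.get i),
      G.Adj (φ (spiderNode l i (k + 1) h)) (φ (spiderNode l i k (by lia)))) :
    Nonempty (G ≃g spider l) := by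
  have hbij := (Fintype.bijective_iff_surjective_and_card φ).2
    ⟨hφ, by rw [spider_card, hcard]⟩
  let e := Equiv.ofBijective φ hbij
  have hle : spider l ≤ G.comap e := by
    intro x y hxy
    obtain ⟨i, k, h, hxy⟩ := spider_adj_iff.1 hxy
    rcases Sym2.eq_iff.1 hxy with ⟨rfl, rfl⟩ | ⟨rfl, rfl⟩
    exacts [hadj i k h, (hadj i k h).symm]
  have htree : (G.comap e).IsTree := (SimpleGraph.Iso.comap e G).isTree_iff.2 hG
  have heq : spider l = G.comap e := le_antisymm hle
    ((SimpleGraph.isTree_iff_minimal_connected.1 htree).2 (spider_connected l) hle)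
  rw [heq]
  exact ⟨(SimpleGraph.Iso.comap e G).symm⟩

theorem sub_le_dist_of_forall_adj {V : Type*} {G : SimpleGraph V} (hG : G.Connected) {f : V → ℤ}
    (hf : ∀ x y, G.Adj x y → f x - f y ≤ 1) (x y : V) : f x - f y ≤ G.dist x y := by
  obtain ⟨p, hp⟩ := hG.exists_walk_length_eq_dist x y
  rw [← hp]
  clear hp
  induction p with
  | nil => simp
  | cons h p ih =>
    have := hf _ _ h
    rw [SimpleGraph.Walk.length_cons]
    lia

theorem get_cons_cons_le {r : ℕ} {L : List ℕ} (hL : ∀ k ∈ L, k ≤ r)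
    {i : Fin ((r + 1) :: r :: L).length} (hi : (i : ℕ) ≠ 0) : ((r + 1) :: r :: L).get i ≤ r := by
  have : ∀ k ∈ r :: L, k ≤ r := by simpa using hL
  obtain ⟨_ | i, h⟩ := i
  · exact absurd rfl hi
  · exact this _ (List.getElem_mem (by simpa using h))

variable {r : ℕ} {L : List ℕ}

/-- Every vertex is at distance at most `r` from one of the two ends of the first edge of the branch
of length `r + 1`. -/
theorem spider_diam_le (hL : ∀ k ∈ L, k ≤ r) :
    (spider ((r + 1) :: r :: L)).diam ≤ 2 * r + 1 := by
  set l := (r + 1) :: r :: L with hl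
  let i₀ : Fin l.length := ⟨0, by simp [hl]⟩
  have hi₀ : l.get i₀ = r + 1 := rfl
  let u := spiderNode l i₀ 1 (by lia)
  have near : ∀ x, (spider l).dist x none ≤ r ∨ (spider l).dist x u ≤ r := by
    intro x
    rcases eq_none_or_spiderNode x with rfl | ⟨i, k, h, rfl⟩
    · simp
    by_cases hi : i = i₀
    · subst hi
      have := spider_dist_node_le (i := i₀) 1 k (by lia)
      simp only [add_comm 1 k] at this
      exact .inr (this.trans (by lia))
    · have := get_cons_cons_le hL (i := i) fun h => hi (Fin.ext h)
      have := spider_dist_node_le (i := i) 0 (k + 1) (by lia)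
      simp only [zero_add] at this
      exact .inl (this.trans (by lia))
  have hconn := spider_connected l
  have hcenter : (spider l).dist none u = 1 :=
    SimpleGraph.dist_eq_one_iff_adj.2 (spider_adj_node (i := i₀) (k := 0) (by lia)).symm
  obtain ⟨x, y, hxy⟩ := (spider l).exists_dist_eq_diam
  have triangle := fun x y z => hconn.dist_triangle (u := x) (v := y) (w := z)
  have := triangle x none y
  have := triangle x u y
  have := triangle none u y
  have := triangle u none y
  simp only [SimpleGraph.dist_comm (v := y), SimpleGraph.dist_comm (u := u) (v := none)] at *
  rcases near x with hx | hx <;> rcases near y with hy | hy <;> lia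

theorem le_spider_diam : 2 * r + 1 ≤ (spider ((r + 1) :: r :: L)).diam := by
  set l := (r + 1) :: r :: L with hl
  let f : Option (Σ i : Fin l.length, Fin (l.get i)) → ℤ := fun x =>
    x.elim 0 fun ⟨i, j⟩ => if (i : ℕ) = 0 then (j : ℤ) + 1 else -((j : ℤ) + 1)
  have f_node : ∀ i k h, f (spiderNode l i k h) = if (i : ℕ) = 0 then (k : ℤ) else -k := by
    rintro i (_ | k) h <;> simp [spiderNode, f]
  have f_adj : ∀ x y, (spider l).Adj x y → f x - f y ≤ 1 := by
    intro x y hxy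
    obtain ⟨i, k, h, hxy⟩ := spider_adj_iff.1 hxy
    rcases Sym2.eq_iff.1 hxy with ⟨rfl, rfl⟩ | ⟨rfl, rfl⟩ <;> rw [f_node, f_node] <;>
      split_ifs <;> push_cast <;> lia
  have hconn := spider_connected l
  have hdist := sub_le_dist_of_forall_adj hconn f_adj
    (spiderNode l ⟨0, by simp [hl]⟩ (r + 1) le_rfl) (spiderNode l ⟨1, by simp [hl]⟩ r le_rfl)
  have hdiam := SimpleGraph.dist_le_diam (SimpleGraph.connected_iff_ediam_ne_top.1 hconn)
    (u := spiderNode l ⟨0, by simp [hl]⟩ (r + 1) le_rfl)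
    (v := spiderNode l ⟨1, by simp [hl]⟩ r le_rfl)
  rw [f_node, f_node, if_pos rfl, if_neg one_ne_zero] at hdist
  lia

theorem spider_isTreeOfOrderDiam (hL : ∀ k ∈ L, k ≤ r) :
    IsTreeOfOrderDiam (2 * r + 2 + L.sum) (2 * r + 1) (spider ((r + 1) :: r :: L)) := by
  refine ⟨spider_isTree _, ?_, (spider_diam_le hL).antisymm le_spider_diam⟩
  rw [spider_card]
  simp only [List.sum_cons]
  lia

end Spider

namespace BicentralForest

open Finset Classical

variable {V : Type*} {G : SimpleGraph V} {r : ℕ} (B : BicentralForest G r) {v w : V} {k : ℕ}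

theorem H_iterate_ch (hk : k ≤ B.H w) : B.H (B.ch^[k] w) + k = B.H w := by
  induction k with
  | zero => rfl
  | succ k ih =>
    have := ih (by lia)
    have := (B.ch_spec (B.ch^[k] w) (by lia)).2
    rw [Function.iterate_succ_apply']
    lia

variable [Fintype V]

theorem swap_tops : B.swap.tops = B.tops := by
  ext v
  rw [mem_tops, mem_tops, IsRoot, or_comm]
  rfl

theorem swap_pathLengths : B.swap.pathLengths = B.pathLengths := by
  rw [pathLengths, swap_tops]
  rfl

theorem exists_iterate_ch_eq (v : V) (hv : v ≠ B.c) :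
    ∃ w, (w = B.a ∨ w = B.ch B.c ∨ w ∈ B.tops) ∧ ∃ k ≤ B.H w, B.ch^[k] w = v := by
  rcases eq_or_ne v B.a with rfl | ha
  · exact ⟨B.a, .inl rfl, 0, Nat.zero_le _, rfl⟩
  have hroot : ¬ B.IsRoot v := by simp [IsRoot, ha, hv]
  by_cases hch : B.ch (B.par v) = v
  · by_cases hc : B.par v = B.c
    · exact ⟨v, .inr (.inl (hc ▸ hch.symm)), 0, Nat.zero_le _, rfl⟩
    · obtain ⟨w, hw, k, hk, hkw⟩ := exists_iterate_ch_eq (B.par v) hc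
      refine ⟨w, hw, k + 1, ?_, by rw [Function.iterate_succ_apply', hkw, hch]⟩
      have := B.H_iterate_ch hk
      have := B.H_lt_H_par hroot
      lia
  · exact ⟨v, .inr (.inr (B.mem_tops.2 ⟨hroot, hch⟩)), 0, Nat.zero_le _, rfl⟩
termination_by r - B.H v
decreasing_by
  have := B.H_lt_H_par hroot
  have := B.H_lt_of_not_isRoot hroot
  lia

theorem nonempty_iso_spider_map (hG : G.IsTree) {ws : List V} (hadj : ∀ w ∈ ws, G.Adj w B.c)
    (hmem : ∀ v, v ≠ B.c → ∃ w ∈ ws, ∃ k ≤ B.H w, B.ch^[k] w = v)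
    (hcard : Fintype.card V = (ws.map fun w => B.H w + 1).sum + 1) :
    Nonempty (G ≃g spider (ws.map fun w => B.H w + 1)) := by
  set l := ws.map fun w => B.H w + 1 with hl
  have hlen : l.length = ws.length := ws.length_map _
  let t : Fin l.length → V := fun i => ws.get (i.cast hlen)
  have get_eq : ∀ i, l.get i = B.H (t i) + 1 := fun i => by simp [hl, t]
  let φ : Option (Σ i : Fin l.length, Fin (l.get i)) → V := fun x =>
    x.elim B.c fun ⟨i, j⟩ => B.ch^[j] (t i)
  refine nonempty_iso_spider hG hcard (φ := φ) (fun v => ?_) fun i k h => ?_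
  · by_cases hv : v = B.c
    · exact ⟨none, hv.symm⟩
    · obtain ⟨w, hw, k, hk, rfl⟩ := hmem v hv
      obtain ⟨i, rfl⟩ := List.get_of_mem hw
      exact ⟨some ⟨i.cast hlen.symm, k, (get_eq (i.cast hlen.symm)).symm ▸ Nat.lt_succ_of_le hk⟩,
        rfl⟩
  · rw [get_eq] at h
    cases k with
    | zero => exact hadj _ (List.get_mem _ _)
    | succ k =>
      change G.Adj (B.ch^[k + 1] (t i)) (B.ch^[k] (t i))
      have := B.H_iterate_ch (w := t i) (k := k) (by lia)
      rw [Function.iterate_succ_apply']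
      exact (B.adj_ch (by lia)).symm

theorem nonempty_iso_spider_of_tops (hG : G.IsTree) (hr : 1 ≤ r)
    (htops : ∀ v ∈ B.tops, B.par v = B.c) {L : List ℕ} (hL : B.pathLengths = L) :
    Nonempty (G ≃g spider ((r + 1) :: r :: L)) := by
  have hperm : L.Perm (B.tops.toList.map fun v => B.H v + 1) := by
    rw [← Multiset.coe_eq_coe, ← Multiset.map_coe, coe_toList]
    exact hL.symm
  obtain ⟨us, rfl, hus⟩ := (congrFun₂ (List.eq_map_comp_perm _) _ _).mpr hperm
  have mem_us : ∀ v, v ∈ us ↔ v ∈ B.tops := fun v => by rw [hus.mem_iff, mem_toList]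
  have hc : 0 < B.H B.c := by rwa [B.H_c]
  have hH := (B.ch_spec B.c hc).2
  rw [B.H_c] at hH
  have hlist : (r + 1) :: r :: us.map (fun v => B.H v + 1) =
      (B.a :: B.ch B.c :: us).map fun v => B.H v + 1 := by
    simp [B.H_a, hH]
  rw [hlist]
  refine B.nonempty_iso_spider_map hG (fun w hw => ?_) (fun v hv => ?_) ?_
  · simp only [List.mem_cons, mem_us] at hw
    rcases hw with rfl | rfl | hw
    · exact B.adj_roots
    · exact (B.adj_ch hc).symm
    · exact htops w hw ▸ B.adj_par (B.mem_tops.1 hw).1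
  · simpa only [List.mem_cons, mem_us] using B.exists_iterate_ch_eq v hv
  · rw [← hlist, B.card_eq, hL, Multiset.sum_coe]
    simp only [List.sum_cons]
    lia

end BicentralForest

section SpiderEigenfunction

open Finset

variable {l : List ℕ} {lam : ℝ} {f : Option (Σ i : Fin l.length, Fin (l.get i)) → ℝ}

theorem graphLaplacian_spiderNode {i : Fin l.length} {k : ℕ} (h : k + 2 ≤ l.get i) :
    graphLaplacian (spider l) f (spiderNode l i (k + 1) (by lia)) =
      2 * f (spiderNode l i (k + 1) (by lia)) - f (spiderNode l i k (by lia)) -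
        f (spiderNode l i (k + 2) h) := by
  classical
  have hne : spiderNode l i k (by lia) ≠ spiderNode l i (k + 2) h := fun e => by
    have := spiderNode_inj.1 e
    lia
  have hfilter : univ.filter ((spider l).Adj (spiderNode l i (k + 1) (by lia))) =
      {spiderNode l i k (by lia), spiderNode l i (k + 2) h} := by
    ext y
    rw [mem_filter_univ, spider_adj_node_succ, mem_insert, mem_singleton, exists_prop_of_true h]
  rw [graphLaplacian]
  convert sum_pair (f := fun y => f (spiderNode l i (k + 1) (by lia)) - f y) hne using 1
  · rw [← hfilter]
  · ring

theorem spider_adj_none_some {i : Fin l.length} {j : Fin (l.get i)} :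
    (spider l).Adj none (some ⟨i, j⟩) ↔ (j : ℕ) = 0 := by
  simp [spider]

theorem graphLaplacian_spider_none (hl : ∀ i : Fin l.length, 1 ≤ l.get i) :
    graphLaplacian (spider l) f none = ∑ i, (f none - f (spiderNode l i 1 (hl i))) := by
  classical
  rw [graphLaplacian, sum_filter, Fintype.sum_option, if_neg (SimpleGraph.irrefl _), zero_add,
    Fintype.sum_sigma]
  refine sum_congr rfl fun i _ => ?_
  rw [sum_eq_single (⟨0, hl i⟩ : Fin (l.get i)) (fun j _ hj => ?_) (by simp)]
  · rw [if_pos (spider_adj_none_some.2 rfl)]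
    rfl
  · rw [if_neg fun h => hj (Fin.ext (spider_adj_none_some.1 h))]

theorem isLeafVertex_spiderNode {i : Fin l.length} {k : ℕ} (h : k + 1 = l.get i) :
    IsLeafVertex (spider l) (spiderNode l i (k + 1) h.le) := by
  refine ⟨spiderNode l i k (by lia), spider_adj_node h.le, fun y hy => ?_⟩
  exact ((spider_adj_node_succ h.le).1 hy).resolve_right fun ⟨h', _⟩ => by lia

theorem not_isLeafVertex_spiderNode {i : Fin l.length} {k : ℕ} (h : k + 2 ≤ l.get i) :
    ¬ IsLeafVertex (spider l) (spiderNode l i (k + 1) (by lia)) := by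
  intro hleaf
  have := spiderNode_inj.1 (hleaf.unique (spider_adj_node (by lia))
    ((spider_adj_node_succ (by lia)).2 (.inr ⟨h, rfl⟩)))
  lia

theorem not_isLeafVertex_spider_none (hl : ∀ i : Fin l.length, 1 ≤ l.get i)
    (h2 : 2 ≤ l.length) : ¬ IsLeafVertex (spider l) none := by
  intro hleaf
  have h := hleaf.unique (spider_adj_node (hl ⟨0, by lia⟩)).symm
    (spider_adj_node (hl ⟨1, by lia⟩)).symm
  simp [spiderNode] at h

theorem eq_of_harmonic_of_steklov {u : ℕ → ℝ} {N : ℕ}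
    (hharm : ∀ k, k + 2 ≤ N → 2 * u (k + 1) - u k - u (k + 2) = 0)
    (hend : ∀ k, k + 1 = N → u (k + 1) - u k = lam * u (k + 1)) {k m : ℕ} (h : k + m = N) :
    u k = (1 - lam * m) * u N := by
  induction m using Nat.twoStepInduction generalizing k with
  | zero => simp [← h]
  | one =>
    obtain rfl := h
    have := hend k rfl
    push_cast
    linarith
  | more m ih1 ih2 =>
    have h1 := ih1 (k := k + 2) (by lia)
    have h2 := ih2 (k := k + 1) (by lia)
    have := hharm k (by lia)
    push_cast at h2 ⊢
    linarith

/-- The leaf at the end of the `i`-th branch of a spider. -/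
abbrev spiderTip (l : List ℕ) (i : Fin l.length) : Option (Σ i : Fin l.length, Fin (l.get i)) :=
  spiderNode l i (l.get i) le_rfl

namespace IsSteklovPair

theorem apply_spiderNode (hf : IsSteklovPair (spider l) lam f) (i : Fin l.length) {k m : ℕ}
    (h : k + m = l.get i) :
    f (spiderNode l i k (by lia)) = (1 - lam * m) * f (spiderTip l i) := by
  let u : ℕ → ℝ := fun k => if h : k ≤ l.get i then f (spiderNode l i k h) else 0
  have hu : ∀ k h, f (spiderNode l i k h) = u k := fun k h => by simp only [u, dif_pos h]
  rw [hu, hu]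
  refine eq_of_harmonic_of_steklov (fun k hk => ?_) (fun k hk => ?_) h
  · rw [← hu _ hk, ← hu (k + 1) (by lia), ← hu k (by lia), ← graphLaplacian_spiderNode hk]
    exact hf.1 _ (not_isLeafVertex_spiderNode hk)
  · rw [← hu _ hk.le, ← hu k (by lia)]
    exact hf.2 _ _ (isLeafVertex_spiderNode hk) (spider_adj_node hk.le)

theorem apply_none (hf : IsSteklovPair (spider l) lam f) (i : Fin l.length) :
    f none = (1 - lam * l.get i) * f (spiderTip l i) :=
  hf.apply_spiderNode i (zero_add _)

theorem sum_spiderTip (hf : IsSteklovPair (spider l) lam f) (h0 : lam ≠ 0)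
    (hl : ∀ i : Fin l.length, 1 ≤ l.get i) (h2 : 2 ≤ l.length) : ∑ i, f (spiderTip l i) = 0 := by
  have slope : ∀ i, f none - f (spiderNode l i 1 (hl i)) = -lam * f (spiderTip l i) := fun i => by
    obtain ⟨m, hm⟩ := Nat.exists_eq_add_of_le (hl i)
    rw [hf.apply_none i, hf.apply_spiderNode i hm.symm, hm]
    push_cast
    ring
  have h := hf.1 none (not_isLeafVertex_spider_none hl h2)
  rw [graphLaplacian_spider_none hl, sum_congr rfl fun i _ => slope i, ← mul_sum] at h
  exact (mul_eq_zero.1 h).resolve_left (neg_ne_zero.2 h0)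

theorem apply_none_ne_zero (hf : IsSteklovPair (spider l) lam f) (hf0 : f ≠ 0)
    (hsum : ∑ i, f (spiderTip l i) = 0) {i₀ : Fin l.length}
    (hne : ∀ i ≠ i₀, 1 - lam * l.get i ≠ 0) : f none ≠ 0 := by
  intro hnone
  have htip : ∀ i ≠ i₀, f (spiderTip l i) = 0 := fun i hi =>
    (mul_eq_zero.1 ((hf.apply_none i).symm.trans hnone)).resolve_left (hne i hi)
  have htip₀ : f (spiderTip l i₀) = 0 := by
    rwa [sum_eq_single i₀ (fun i _ hi => htip i hi) (by simp)] at hsum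
  refine hf0 (funext fun y => ?_)
  rcases eq_none_or_spiderNode y with rfl | ⟨i, k, h, rfl⟩
  · exact hnone
  · obtain ⟨m, hm⟩ := Nat.exists_eq_add_of_le h
    rw [hf.apply_spiderNode i hm.symm]
    rcases eq_or_ne i i₀ with rfl | hi
    · rw [htip₀, mul_zero, Pi.zero_apply]
    · rw [htip i hi, mul_zero, Pi.zero_apply]

theorem sum_response_eq_zero (hf : IsSteklovPair (spider l) lam f) (hnone : f none ≠ 0)
    (hsum : ∑ i, f (spiderTip l i) = 0) : (l.map (response lam)).sum = 0 := by
  have tip_eq : ∀ i : Fin l.length, response lam l[i.1] = lam / f none * f (spiderTip l i) := by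
    intro i
    have hmul : (1 - lam * l[i.1]) * f (spiderTip l i) ≠ 0 := hf.apply_none i ▸ hnone
    rw [show f none = (1 - lam * l[i.1]) * f (spiderTip l i) from hf.apply_none i, response]
    have := left_ne_zero_of_mul hmul
    have := right_ne_zero_of_mul hmul
    field_simp
  rw [← Fin.sum_univ_fun_getElem, sum_congr rfl fun i _ => tip_eq i, ← mul_sum, hsum, mul_zero]

end IsSteklovPair

theorem secular_eq_one {r : ℕ} {s : Multiset ℕ} (hs : ∀ k ∈ s, k ≤ r) (h0 : 0 < lam)
    (hlam : lam * r < 1) (hne : 1 - lam * (r + 1) ≠ 0)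
    (hsum : response lam (r + 1) + (response lam r + (s.map (response lam)).sum) = 0) :
    1 < lam * (r + 1) ∧ secular lam r s = 1 := by
  have hr := response_pos h0 hlam le_rfl
  have hS := sum_response_nonneg h0 hlam hs
  have hp := one_sub_mul_pos h0 hlam le_rfl
  refine ⟨?_, ?_⟩
  · by_contra! hle
    have : 0 < response lam (r + 1) := by
      refine div_pos h0 (lt_of_le_of_ne ?_ ?_)
      · push_cast
        linarith
      · exact_mod_cast hne.symm
    linarith
  · rw [secular, show (s.map (response lam)).sum = -response lam (r + 1) - response lam r by
      linarith, response, response]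
    push_cast
    field_simp
    ring

theorem spider_secular {r : ℕ} (hr : 1 ≤ r) {L : List ℕ} (hL : ∀ k ∈ L, 1 ≤ k ∧ k ≤ r)
    (h0 : 0 < lam) (hlam : lam * r < 1)
    (hev : IsSteklovEigenvalue (spider ((r + 1) :: r :: L)) lam) :
    1 < lam * (r + 1) ∧ secular lam r L = 1 := by
  obtain ⟨-, f, hf0, hf⟩ := hev
  replace hf : IsSteklovPair (spider ((r + 1) :: r :: L)) lam f := hf
  let i₀ : Fin ((r + 1) :: r :: L).length := ⟨0, by simp⟩
  have hpos : ∀ i, 1 ≤ ((r + 1) :: r :: L).get i := fun i => by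
    have hmem := List.get_mem ((r + 1) :: r :: L) i
    simp only [List.mem_cons] at hmem
    rcases hmem with h | h | h
    exacts [by lia, by lia, (hL _ h).1]
  have hne : ∀ i ≠ i₀, 1 - lam * ((r + 1) :: r :: L).get i ≠ 0 := fun i hi =>
    (one_sub_mul_pos h0 hlam
      (get_cons_cons_le (fun k hk => (hL k hk).2) fun h => hi (Fin.ext h))).ne'
  have htips := hf.sum_spiderTip h0.ne' hpos (by simp)
  have hnone := hf.apply_none_ne_zero hf0 htips hne
  have hne₀ : 1 - lam * ((r : ℝ) + 1) ≠ 0 := by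
    have := left_ne_zero_of_mul (hf.apply_none i₀ ▸ hnone)
    exact_mod_cast this
  refine secular_eq_one (fun k hk => (hL k hk).2) h0 hlam hne₀ ?_
  simpa using hf.sum_response_eq_zero hnone htips

end SpiderEigenfunction

section EvenParts

open Multiset

/-- The partition of `M` into `q` parts any two of which differ by at most one. -/
def evenParts (M q : ℕ) : Multiset ℕ :=
  replicate (M % q) (M / q + 1) + replicate (q - M % q) (M / q)

variable {M q r k e : ℕ}

theorem card_evenParts (hq : 0 < q) : card (evenParts M q) = q := by
  have := Nat.mod_lt M hq
  simp only [evenParts, card_add, card_replicate]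
  lia

theorem sum_evenParts (hq : 0 < q) : (evenParts M q).sum = M := by
  obtain ⟨m, hm⟩ := Nat.exists_eq_add_of_le (Nat.mod_lt M hq).le
  have hsub : q - M % q = m := by lia
  simp only [evenParts, sum_add, sum_replicate, smul_eq_mul, hsub]
  calc M % q * (M / q + 1) + m * (M / q) = (M % q + m) * (M / q) + M % q := by ring
    _ = M := by rw [← hm, Nat.div_add_mod]

theorem mem_evenParts (hk : k ∈ evenParts M q) : k = M / q ∨ k = M / q + 1 ∧ M % q ≠ 0 := by
  simp only [evenParts, mem_add, mem_replicate] at hk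
  lia

theorem mem_evenParts_of_eq_mul (hq : 0 < q) (hM : M = q * e) (hk : k ∈ evenParts M q) :
    k = e := by
  subst hM
  simpa [Nat.mul_div_cancel_left _ hq] using mem_evenParts hk

theorem mem_evenParts_bounds (hq : 0 < q) (hqM : q ≤ M) (hMr : M ≤ q * r)
    (hk : k ∈ evenParts M q) : 1 ≤ k ∧ k ≤ r := by
  have hpos := Nat.div_pos hqM hq
  have hle : M / q ≤ r := Nat.div_le_of_le_mul hMr
  rcases mem_evenParts hk with rfl | ⟨rfl, hmod⟩
  · exact ⟨hpos, hle⟩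
  · refine ⟨by lia, hle.lt_of_ne fun h => ?_⟩
    have := Nat.div_add_mod M q
    rw [h] at this
    lia

theorem exists_eq_replicate_add_replicate {s : Multiset ℕ} (hs : ∀ k ∈ s, k = e ∨ k = e + 1) :
    ∃ m n, s = replicate m e + replicate n (e + 1) := by
  refine ⟨count e s, card (s.filter (¬ · = e)), ?_⟩
  rw [← filter_eq', ← eq_replicate_card.2 fun k hk => ?_, filter_add_not]
  rw [mem_filter] at hk
  exact (hs k hk.1).resolve_left hk.2

theorem eq_of_card_eq_of_sum_eq {s s' : Multiset ℕ} (hs : ∀ k ∈ s, k = e ∨ k = e + 1)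
    (hs' : ∀ k ∈ s', k = e ∨ k = e + 1) (hcard : card s = card s') (hsum : s.sum = s'.sum) :
    s = s' := by
  obtain ⟨m, n, rfl⟩ := exists_eq_replicate_add_replicate hs
  obtain ⟨m', n', rfl⟩ := exists_eq_replicate_add_replicate hs'
  simp only [card_add, card_replicate, sum_add, sum_replicate, smul_eq_mul, mul_add_one,
    ← add_assoc, ← add_mul] at hcard hsum
  rw [hcard] at hsum
  obtain rfl : n = n' := Nat.add_left_cancel hsum
  rw [Nat.add_right_cancel hcard]

end EvenParts

section Chord

variable {lam : ℝ} {r k e : ℕ}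

/-- The affine function that agrees with `response lam` at `e` and `e + 1`. -/
noncomputable def responseChord (lam : ℝ) (e : ℕ) (x : ℝ) : ℝ :=
  lam * (1 - lam * (2 * e + 1 - x)) / ((1 - lam * e) * (1 - lam * (e + 1)))

theorem response_sub_responseChord (he : 1 - lam * e ≠ 0) (he' : 1 - lam * (e + 1) ≠ 0)
    (hk : 1 - lam * k ≠ 0) :
    response lam k - responseChord lam e k =
      lam ^ 3 * ((k - e) * (k - (e + 1))) /
        ((1 - lam * k) * ((1 - lam * e) * (1 - lam * (e + 1)))) := by
  rw [response, responseChord]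
  field_simp
  ring

theorem one_sub_mul_add_one_pos (h0 : 0 < lam) (hlam : lam * r < 1) (he : e + 1 ≤ r) :
    0 < 1 - lam * (e + 1) := by
  exact_mod_cast one_sub_mul_pos h0 hlam he

theorem response_eq_responseChord (h0 : 0 < lam) (hlam : lam * r < 1) (he : e + 1 ≤ r)
    (hk : k = e ∨ k = e + 1) : response lam k = responseChord lam e k := by
  rw [← sub_eq_zero, response_sub_responseChord (one_sub_mul_pos h0 hlam (by lia)).ne'
    (one_sub_mul_add_one_pos h0 hlam he).ne' (one_sub_mul_pos h0 hlam (by lia)).ne']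
  rcases hk with rfl | rfl <;> simp

theorem responseChord_lt_response (h0 : 0 < lam) (hlam : lam * r < 1) (he : e + 1 ≤ r)
    (hkr : k ≤ r) (hke : k ≠ e) (hke' : k ≠ e + 1) : responseChord lam e k < response lam k := by
  have hk := one_sub_mul_pos h0 hlam hkr
  have he₀ := one_sub_mul_pos h0 hlam (Nat.le_of_succ_le he)
  have he₁ := one_sub_mul_add_one_pos h0 hlam he
  have hprod : (0 : ℝ) < (k - e) * (k - (e + 1)) := by
    rcases hke.lt_or_gt with h | h
    · have h : (k : ℝ) < e := by exact_mod_cast h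
      exact mul_pos_of_neg_of_neg (by linarith) (by linarith)
    · have h : (e + 1 : ℝ) < k := by exact_mod_cast (by lia : e + 1 < k)
      exact mul_pos (by linarith) (by linarith)
  rw [← sub_pos, response_sub_responseChord he₀.ne' he₁.ne' hk.ne']
  positivity

theorem responseChord_le_response (h0 : 0 < lam) (hlam : lam * r < 1) (he : e + 1 ≤ r)
    (hkr : k ≤ r) : responseChord lam e k ≤ response lam k := by
  by_cases hk : k = e ∨ k = e + 1
  · exact (response_eq_responseChord h0 hlam he hk).ge
  · rw [not_or] at hk
    exact (responseChord_lt_response h0 hlam he hkr hk.1 hk.2).le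

theorem responseChord_zero_pos (h0 : 0 < lam) (hlam : lam * r < 1) (he : 2 * e + 1 ≤ r) :
    0 < responseChord lam e 0 := by
  have he₀ := one_sub_mul_pos h0 hlam (by lia : e ≤ r)
  have he₁ := one_sub_mul_add_one_pos h0 hlam (by lia : e + 1 ≤ r)
  have hnum : 0 < 1 - lam * (2 * e + 1 - 0) := by
    rw [sub_zero]
    exact_mod_cast one_sub_mul_pos h0 hlam he
  rw [responseChord]
  positivity

theorem responseChord_zero_neg (h0 : 0 < lam) (hlam : lam * r < 1) (hlam' : 1 < lam * (r + 1))
    (he : e + 1 ≤ r) (hre : r ≤ 2 * e) : responseChord lam e 0 < 0 := by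
  have he₀ := one_sub_mul_pos h0 hlam (by lia : e ≤ r)
  have he₁ := one_sub_mul_add_one_pos h0 hlam he
  have hre : (r : ℝ) ≤ 2 * e := by exact_mod_cast hre
  refine div_neg_of_neg_of_pos (mul_neg_of_pos_of_neg h0 ?_) (mul_pos he₀ he₁)
  nlinarith

theorem sum_responseChord (s : Multiset ℕ) :
    (s.map fun k : ℕ => responseChord lam e k).sum = s.card * responseChord lam e 0 +
      lam ^ 2 / ((1 - lam * e) * (1 - lam * (e + 1))) * s.sum := by
  have affine : ∀ k : ℕ, responseChord lam e k =
      responseChord lam e 0 + lam ^ 2 / ((1 - lam * e) * (1 - lam * (e + 1))) * k := fun k => by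
    rw [responseChord, responseChord]
    ring
  simp_rw [affine]
  rw [Multiset.sum_map_add, Multiset.map_const', Multiset.sum_replicate, nsmul_eq_mul,
    Multiset.sum_map_mul_left, Nat.cast_multiset_sum]

/-- The chord supports the convex response, and the sign of its value at `0` says whether more or
fewer parts are better. -/
theorem sum_response_lt (hlam : lam * r < 1) (hlam' : 1 < lam * (r + 1)) (he : e + 1 ≤ r)
    {s s₀ : Multiset ℕ} (hs : ∀ k ∈ s, k ≤ r) (hs₀ : ∀ k ∈ s₀, k = e ∨ k = e + 1)
    (hsum : s.sum = s₀.sum)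
    (hcard : 2 * e + 1 ≤ r ∧ s₀.card ≤ s.card ∨ r ≤ 2 * e ∧ s.card ≤ s₀.card) (hne : s ≠ s₀) :
    (s₀.map (response lam)).sum < (s.map (response lam)).sum := by
  have h0 := pos_of_one_lt_mul_add_one hlam'
  have hle : (s.map fun k : ℕ => responseChord lam e k).sum ≤ (s.map (response lam)).sum :=
    Multiset.sum_map_le_sum_map _ _ fun k hk => responseChord_le_response h0 hlam he (hs k hk)
  have heq : (s₀.map (response lam)).sum = (s₀.map fun k : ℕ => responseChord lam e k).sum :=
    congrArg _ (Multiset.map_congr rfl fun k hk => response_eq_responseChord h0 hlam he (hs₀ k hk))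
  rw [heq]
  by_cases hc : s.card = s₀.card
  · have hex : ∃ k ∈ s, ¬ (k = e ∨ k = e + 1) := by
      by_contra! h
      exact hne (eq_of_card_eq_of_sum_eq h hs₀ hc hsum)
    obtain ⟨k, hk, hke⟩ := hex
    rw [not_or] at hke
    calc _ = (s.map fun k : ℕ => responseChord lam e k).sum := by
          rw [sum_responseChord, sum_responseChord, hc, hsum]
      _ < _ := Multiset.sum_lt_sum
          (fun k hk => responseChord_le_response h0 hlam he (hs k hk))
          ⟨k, hk, responseChord_lt_response h0 hlam he (hs k hk) hke.1 hke.2⟩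
  · refine lt_of_lt_of_le ?_ hle
    rw [sum_responseChord, sum_responseChord, hsum]
    refine add_lt_add_left ?_ _
    rcases hcard with ⟨hre, hle⟩ | ⟨hre, hle⟩
    · exact mul_lt_mul_of_pos_right (by exact_mod_cast hle.lt_of_ne' hc)
        (responseChord_zero_pos h0 hlam hre)
    · exact mul_lt_mul_of_neg_right (by exact_mod_cast hle.lt_of_ne hc)
        (responseChord_zero_neg h0 hlam hlam' he hre)

end Chord

section OptimalParts

variable {r s M : ℕ}

/-- Among the path lengths of trees of diameter `2 * r + 1`, `s₀` is at least as good as `s`: its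
total response is smaller at every `lam` between `1 / (r + 1)` and `1 / r`, unless `s = s₀`. -/
def ResponseLE (r : ℕ) (s₀ s : Multiset ℕ) : Prop :=
  s ≠ s₀ → ∀ lam : ℝ, lam * r < 1 → 1 < lam * (r + 1) →
    (s₀.map (response lam)).sum < (s.map (response lam)).sum

theorem ceilDiv_pos (hs : 0 < s) (hM : 0 < M) : 0 < M ⌈/⌉ s :=
  Nat.pos_of_ne_zero fun h => by simpa [hM.ne'] using (ceilDiv_le_iff_le_mul hs).1 h.le

theorem le_mul_ceilDiv (hs : 0 < s) : M ≤ s * (M ⌈/⌉ s) := (ceilDiv_le_iff_le_mul hs).1 le_rfl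

theorem responseLE_evenParts_ceilDiv (hr : 0 < r) (hs : s = (r + 1) / 2) (hM : 0 < M)
    {p : Multiset ℕ} (hp : ∀ k ∈ p, k ≤ r) (hsum : p.sum = M) (hcard : M ≤ s * p.card) :
    ResponseLE r (evenParts M (M ⌈/⌉ s)) p := by
  intro hne lam hlam hlam'
  have hs0 : 0 < s := by lia
  set q := M ⌈/⌉ s
  have hq : 0 < q := ceilDiv_pos hs0 hM
  have hMq : M ≤ s * q := le_mul_ceilDiv hs0
  have hqcard : q ≤ p.card := (ceilDiv_le_iff_le_mul hs0).2 hcard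
  have hsum' := hsum.trans (sum_evenParts hq).symm
  rcases hMq.eq_or_lt with heq | hlt
  · refine sum_response_lt hlam hlam' (e := s - 1) (by lia) hp (fun k hk => ?_) hsum'
      (.inl ⟨by lia, by rwa [card_evenParts hq]⟩) hne
    have := mem_evenParts_of_eq_mul hq (heq.trans (mul_comm s q)) hk
    lia
  · have := Nat.div_lt_of_lt_mul (hlt.trans_eq (mul_comm s q))
    exact sum_response_lt hlam hlam' (by lia) hp (fun k hk => (mem_evenParts hk).imp_right And.left)
      hsum' (.inl ⟨by lia, by rwa [card_evenParts hq]⟩) hne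

theorem responseLE_evenParts_div (hs : s = (r + 1) / 2) (hM : 0 < M)
    {p : Multiset ℕ} (hp : ∀ k ∈ p, k ≤ r) (hsum : p.sum = M) (hcard : s * p.card < M) :
    ResponseLE r (evenParts M (max 1 (M / s))) p := by
  intro hne lam hlam hlam'
  have hMr : M ≤ p.card * r := hsum ▸ Multiset.sum_le_card_nsmul p r hp
  have hr : 0 < r := Nat.pos_of_mul_pos_left (hM.trans_le hMr)
  have hs0 : 0 < s := by lia
  have hcard0 : 0 < p.card := Nat.pos_of_mul_pos_right (hM.trans_le hMr)
  have hcardq : p.card ≤ M / s := (Nat.le_div_iff_mul_le hs0).2 (by lia)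
  rw [max_eq_right (hcard0.trans_le hcardq)] at hne ⊢
  set q := M / s with hqM
  have hq : 0 < q := hcard0.trans_le hcardq
  have hsq : s ≤ M / q := (Nat.le_div_iff_mul_le hq).2 (hqM ▸ Nat.mul_div_le M s)
  have hsum' := hsum.trans (sum_evenParts hq).symm
  rcases lt_or_ge (M / q) r with hlt | hge
  · exact sum_response_lt hlam hlam' hlt hp (fun k hk => (mem_evenParts hk).imp_right And.left)
      hsum' (.inr ⟨by lia, by rwa [card_evenParts hq]⟩) hne
  · have hqr : r * q ≤ M := (Nat.le_div_iff_mul_le hq).1 hge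
    have hcard_eq : p.card = q :=
      hcardq.antisymm (Nat.le_of_mul_le_mul_right ((mul_comm q r).trans_le hqr |>.trans hMr) hr)
    have hMeq : M = q * r := le_antisymm (hcard_eq ▸ hMr) (mul_comm q r ▸ hqr)
    refine sum_response_lt hlam hlam' (e := r - 1) (by lia) hp (fun k hk => ?_) hsum'
      (by rw [card_evenParts hq]; lia) hne
    have := mem_evenParts_of_eq_mul hq hMeq hk
    lia

theorem max_div_le (hM : 0 < M) : max 1 (M / s) ≤ M := max_le hM (Nat.div_le_self M s)

theorem le_max_div_mul (hr : 0 < r) (hs : s = (r + 1) / 2) : M ≤ max 1 (M / s) * r := by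
  have hlt := Nat.lt_mul_div_succ M (by lia : 0 < s)
  rcases Nat.eq_zero_or_pos (M / s) with hz | hpos
  · rw [hz] at hlt ⊢
    lia
  · rw [max_eq_right hpos]
    calc M ≤ s * (M / s) + (s - 1) := by rw [mul_add_one] at hlt; lia
      _ ≤ s * (M / s) + (s - 1) * (M / s) := by gcongr; exact Nat.le_mul_of_pos_right _ hpos
      _ = (s + (s - 1)) * (M / s) := (add_mul ..).symm
      _ ≤ r * (M / s) := Nat.mul_le_mul_right _ (by lia)
      _ = M / s * r := mul_comm ..

theorem ceilDiv_le_self (hs : 0 < s) : M ⌈/⌉ s ≤ M :=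
  (ceilDiv_le_iff_le_mul hs).2 (Nat.le_mul_of_pos_left M hs)

theorem le_ceilDiv_mul (hs0 : 0 < s) (hsr : s ≤ r) : M ≤ (M ⌈/⌉ s) * r :=
  (le_mul_ceilDiv hs0).trans (by rw [mul_comm]; exact Nat.mul_le_mul_left _ hsr)

end OptimalParts

section Extremal

variable {r : ℕ}

theorem exists_bicentralForest_of_isTreeOfOrderDiam {V : Type*} [Fintype V] {G : SimpleGraph V}
    {n : ℕ} (hG : IsTreeOfOrderDiam n (2 * r + 1) G) :
    ∃ B : BicentralForest G r, 2 * r + 2 + B.pathLengths.sum = n := by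
  obtain ⟨htree, hcard, hdiam⟩ := hG
  have := htree.connected.nonempty
  have hfin := SimpleGraph.connected_iff_ediam_ne_top.1 htree.connected
  obtain ⟨B⟩ := exists_bicentralForest htree hfin hdiam
  exact ⟨B, B.card_eq.symm.trans hcard⟩

theorem two_div_mul_lt_one : (2 / (2 * r + 1) : ℝ) * r < 1 := by
  rw [div_mul_eq_mul_div, div_lt_one (by positivity)]
  linarith

theorem one_lt_two_div_mul : 1 < (2 / (2 * r + 1) : ℝ) * (r + 1) := by
  rw [div_mul_eq_mul_div, one_lt_div (by positivity)]
  linarith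

theorem response_two_div : response (2 / (2 * r + 1)) r = 2 := by
  have h : 1 - 2 / (2 * r + 1) * (r : ℝ) = 1 / (2 * r + 1) := by
    field_simp
    ring
  rw [response, h]
  field_simp

theorem steklovLambda2_le_two_div {V : Type*} [Fintype V] {G : SimpleGraph V} (hr : 1 ≤ r)
    (hG : G.Preconnected) (B : BicentralForest G r) : steklovLambda2 G ≤ 2 / (2 * r + 1) := by
  have hS := sum_response_nonneg (pos_of_one_lt_mul_add_one one_lt_two_div_mul) two_div_mul_lt_one
    fun k hk => (B.mem_pathLengths_bounds hk).2
  refine (B.steklovLambda2_le hG hr two_div_mul_lt_one one_lt_two_div_mul ?_).1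
  rw [secular, response_two_div]
  linarith

theorem steklovLambda2_spider (hr : 1 ≤ r) {L : List ℕ} (hL : ∀ k ∈ L, 1 ≤ k ∧ k ≤ r) :
    steklovLambda2 (spider ((r + 1) :: r :: L)) * r < 1 ∧
      1 < steklovLambda2 (spider ((r + 1) :: r :: L)) * (r + 1) ∧
      secular (steklovLambda2 (spider ((r + 1) :: r :: L))) r L = 1 := by
  have htree := spider_isTreeOfOrderDiam fun k hk => (hL k hk).2
  have hconn := htree.1.connected.preconnected
  obtain ⟨B, -⟩ := exists_bicentralForest_of_isTreeOfOrderDiam htree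
  obtain ⟨⟨hpos, hev⟩, -⟩ := isLeast_steklovLambda2 hconn (B.one_lt_card_leaves hr)
  have hlt := (mul_le_mul_of_nonneg_right (steklovLambda2_le_two_div hr hconn B)
    r.cast_nonneg).trans_lt two_div_mul_lt_one
  exact ⟨hlt, spider_secular hr hL hpos hlt hev⟩

theorem BicentralForest.nonempty_iso_spider_of_tops_par_eq {V : Type*} [Fintype V]
    {G : SimpleGraph V} (B : BicentralForest G r) (hG : G.IsTree) (hr : 1 ≤ r)
    (htops : (∀ v ∈ B.tops, B.par v = B.a) ∨ ∀ v ∈ B.tops, B.par v = B.c) {L : List ℕ}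
    (hL : B.pathLengths = L) : Nonempty (G ≃g spider ((r + 1) :: r :: L)) := by
  rcases htops with h | h
  · exact B.swap.nonempty_iso_spider_of_tops hG hr (by rw [B.swap_tops]; exact h)
      (by rw [B.swap_pathLengths, hL])
  · exact B.nonempty_iso_spider_of_tops hG hr h hL

/-- `G` is isomorphic to `A`, or its `λ₂` is smaller. -/
def IsoOrLambda2LT {V W : Type*} [Fintype V] [Fintype W] (G : SimpleGraph V) (A : SimpleGraph W) :
    Prop :=
  Nonempty (G ≃g A) ∨ steklovLambda2 G < steklovLambda2 A

theorem IsoOrLambda2LT.steklovLambda2_le {V W : Type*} [Fintype V] [Fintype W] {G : SimpleGraph V}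
    {A : SimpleGraph W} (h : IsoOrLambda2LT G A) : steklovLambda2 G ≤ steklovLambda2 A :=
  h.elim (fun ⟨e⟩ => (steklovLambda2_iso e).le) le_of_lt

theorem BicentralForest.isoOrLambda2LT_spider {V : Type*} [Fintype V] {G : SimpleGraph V}
    (B : BicentralForest G r) (hG : G.IsTree) (hr : 1 ≤ r) {L : List ℕ}
    (hL : ∀ k ∈ L, 1 ≤ k ∧ k ≤ r) (hle : ResponseLE r L B.pathLengths) :
    IsoOrLambda2LT G (spider ((r + 1) :: r :: L)) := by
  obtain ⟨hmu, hmu', hsec⟩ := steklovLambda2_spider hr hL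
  set mu := steklovLambda2 (spider ((r + 1) :: r :: L))
  have bound := B.steklovLambda2_le hG.connected.preconnected hr hmu hmu'
  by_cases heq : B.pathLengths = L
  · obtain ⟨hle, hiso⟩ := bound (by rw [heq, hsec])
    rcases hle.eq_or_lt with h | h
    · exact .inl (B.nonempty_iso_spider_of_tops_par_eq hG hr (hiso h).1 heq)
    · exact .inr h
  · have hlt : 1 < secular mu r B.pathLengths := hsec ▸ mul_lt_mul_of_pos_left
      ((add_lt_add_iff_left _).2 (hle heq mu hmu hmu')) (sub_pos.2 (one_lt_response hmu hmu'))
    obtain ⟨hle, hiso⟩ := bound hlt.le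
    exact .inr (hle.lt_of_ne fun h => hlt.ne' (hiso h).2)

section Abstract

variable {V W : Type} [Fintype V] [Fintype W] {n D : ℕ} {A : SimpleGraph V} {A' : SimpleGraph W}

theorem isUniqueExtremizer_of_forall_isoOrLambda2LT (hA : IsTreeOfOrderDiam n D A)
    (h : ∀ (U : Type) [Fintype U] (G : SimpleGraph U), IsTreeOfOrderDiam n D G →
      IsoOrLambda2LT G A) : IsUniqueExtremizer n D A :=
  ⟨⟨hA, fun U _ G hG => (h U G hG).steklovLambda2_le⟩,
    fun U _ G hG => (h U G hG.1).resolve_right (hG.2 V A hA).not_gt⟩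

theorem IsUniqueExtremizer.of_iso (e : A ≃g A') (h : IsUniqueExtremizer n D A') :
    IsUniqueExtremizer n D A := by
  obtain ⟨⟨htree, hmax⟩, huniq⟩ := h
  refine ⟨⟨htree.of_iso e, fun U _ G hG => ?_⟩, fun U _ G hG => ?_⟩
  · rw [steklovLambda2_iso e]
    exact hmax U G hG
  · exact (huniq U G hG).map fun e' => e'.trans e.symm

/-- Two trees of order `n` and diameter `D` such that every tree of this kind is isomorphic to one
of them or has a smaller `λ₂` than one of them. -/
structure IsDominatingPair (n D : ℕ) (A : SimpleGraph V) (A' : SimpleGraph W) : Prop where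
  left : IsTreeOfOrderDiam n D A
  right : IsTreeOfOrderDiam n D A'
  isoOrLambda2LT : ∀ (U : Type) [Fintype U] (G : SimpleGraph U), IsTreeOfOrderDiam n D G →
    IsoOrLambda2LT G A ∨ IsoOrLambda2LT G A'

namespace IsDominatingPair

theorem symm (h : IsDominatingPair n D A A') : IsDominatingPair n D A' A :=
  ⟨h.right, h.left, fun U _ G hG => (h.isoOrLambda2LT U G hG).symm⟩

theorem isGreatest (h : IsDominatingPair n D A A') :
    IsGreatest {x : ℝ | ∃ (U : Type) (_ : Fintype U) (G : SimpleGraph U),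
      IsTreeOfOrderDiam n D G ∧ steklovLambda2 G = x}
      (max (steklovLambda2 A) (steklovLambda2 A')) := by
  refine ⟨?_, ?_⟩
  · rcases max_choice (steklovLambda2 A) (steklovLambda2 A') with hmax | hmax
    exacts [⟨V, _, A, h.left, hmax.symm⟩, ⟨W, _, A', h.right, hmax.symm⟩]
  · rintro x ⟨U, _, G, hG, rfl⟩
    exact le_max_iff.2 <| (h.isoOrLambda2LT U G hG).imp IsoOrLambda2LT.steklovLambda2_le
      IsoOrLambda2LT.steklovLambda2_le

theorem nonempty_iso {U : Type} [Fintype U] {G : SimpleGraph U} (h : IsDominatingPair n D A A')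
    (hG : IsExtremizer n D G) : Nonempty (G ≃g A) ∨ Nonempty (G ≃g A') :=
  (h.isoOrLambda2LT U G hG.1).imp (Or.resolve_right · (hG.2 V A h.left).not_gt)
    (Or.resolve_right · (hG.2 W A' h.right).not_gt)

theorem isUniqueExtremizer_of_lt (h : IsDominatingPair n D A A')
    (hlt : steklovLambda2 A' < steklovLambda2 A) : IsUniqueExtremizer n D A :=
  isUniqueExtremizer_of_forall_isoOrLambda2LT h.left fun U _ G hG =>
    (h.isoOrLambda2LT U G hG).elim id fun hG' => .inr (hG'.steklovLambda2_le.trans_lt hlt)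

theorem isUniqueExtremizer_of_self (h : IsDominatingPair n D A A) : IsUniqueExtremizer n D A :=
  isUniqueExtremizer_of_forall_isoOrLambda2LT h.left fun U _ G hG =>
    (h.isoOrLambda2LT U G hG).elim id id

end IsDominatingPair

end Abstract

/-- The almost seesaw tree in which `M` vertices are distributed as evenly as possible among `q`
additional branches. -/
abbrev evenSeesaw (r M q : ℕ) := almostSeesaw r (q + 2) (M / q) (M % q)

/-- The lengths of the additional branches of `evenSeesaw r M q`, in the shape in which they unfold
from `almostSeesawLengths`. -/
abbrev evenLengths (M q : ℕ) : List ℕ :=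
  List.replicate (M % q) (M / q + 1) ++ List.replicate (q + 2 - 2 - M % q) (M / q)

theorem coe_evenLengths (M q : ℕ) : (evenLengths M q : Multiset ℕ) = evenParts M q := rfl

variable {M q s : ℕ}

theorem mem_evenLengths_bounds (hq : 0 < q) (hqM : q ≤ M) (hMr : M ≤ q * r) :
    ∀ k ∈ evenLengths M q, 1 ≤ k ∧ k ≤ r := fun _ hk =>
  mem_evenParts_bounds hq hqM hMr (coe_evenLengths M q ▸ Multiset.mem_coe.2 hk)

theorem evenSeesaw_isTreeOfOrderDiam (hq : 0 < q) (hqM : q ≤ M) (hMr : M ≤ q * r) :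
    IsTreeOfOrderDiam (2 * r + 2 + M) (2 * r + 1) (evenSeesaw r M q) := by
  have hsum : (evenLengths M q).sum = M := by
    rw [← Multiset.sum_coe, coe_evenLengths, sum_evenParts hq]
  have htree := spider_isTreeOfOrderDiam fun k hk => (mem_evenLengths_bounds hq hqM hMr k hk).2
  rwa [hsum] at htree

theorem isDominatingPair_evenSeesaw (hr : 1 ≤ r) (hs : s = (r + 1) / 2) (hM : 0 < M) :
    IsDominatingPair (2 * r + 2 + M) (2 * r + 1) (evenSeesaw r M (max 1 (M / s)))
      (evenSeesaw r M (M ⌈/⌉ s)) := by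
  have hs0 : 0 < s := by lia
  have hq : 0 < max 1 (M / s) := by lia
  have hq' := ceilDiv_pos hs0 hM
  have hqr : M ≤ max 1 (M / s) * r := le_max_div_mul hr hs
  have hqr' : M ≤ (M ⌈/⌉ s) * r := le_ceilDiv_mul hs0 (by lia)
  refine ⟨evenSeesaw_isTreeOfOrderDiam hq (max_div_le hM) hqr,
    evenSeesaw_isTreeOfOrderDiam hq' (ceilDiv_le_self hs0) hqr', fun U _ G hG => ?_⟩
  obtain ⟨B, hB⟩ := exists_bicentralForest_of_isTreeOfOrderDiam hG
  have hsum : B.pathLengths.sum = M := by lia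
  have hle : ∀ k ∈ B.pathLengths, k ≤ r := fun k hk => (B.mem_pathLengths_bounds hk).2
  rcases lt_or_ge (s * B.pathLengths.card) M with hcard | hcard
  · exact .inl <| B.isoOrLambda2LT_spider hG.1 hr (mem_evenLengths_bounds hq (max_div_le hM) hqr)
      (responseLE_evenParts_div hs hM hle hsum hcard)
  · exact .inr <| B.isoOrLambda2LT_spider hG.1 hr
      (mem_evenLengths_bounds hq' (ceilDiv_le_self hs0) hqr')
      (responseLE_evenParts_ceilDiv hr hs hM hle hsum hcard)

end Extremal

section Path

open SimpleGraph

theorem pathGraph_isTree (k : ℕ) : (pathGraph (k + 1)).IsTree :=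
  isTree_of_forall_adj_parent (pathGraph_connected k) 0 (fun x => ⟨x - 1, by lia⟩) fun x y h => by
    simp only [pathGraph_adj, ne_eq, Fin.ext_iff, Fin.val_zero] at h ⊢
    lia

theorem pathGraph_diam (k : ℕ) : (pathGraph (k + 1)).diam = k := by
  have hconn := pathGraph_connected k
  refine le_antisymm ?_ ?_
  · obtain ⟨x, y, hxy⟩ := (pathGraph (k + 1)).exists_dist_eq_diam
    obtain ⟨p, hp, hlen⟩ := hconn.exists_path_of_dist x y
    have := hp.length_lt
    rw [Fintype.card_fin] at this
    lia
  · have hdist := sub_le_dist_of_forall_adj hconn (f := fun x : Fin (k + 1) => ((x : ℕ) : ℤ))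
      (fun x y h => by rw [pathGraph_adj] at h; lia) (Fin.last k) 0
    have := dist_le_diam (connected_iff_ediam_ne_top.1 hconn) (u := Fin.last k) (v := 0)
    simp only [Fin.val_last, Fin.val_zero] at hdist
    lia

theorem nonempty_iso_spider_of_order_eq {r : ℕ} (hr : 1 ≤ r) {V : Type*} [Fintype V]
    {G : SimpleGraph V} (hG : IsTreeOfOrderDiam (2 * r + 2) (2 * r + 1) G) :
    Nonempty (G ≃g spider [r + 1, r]) := by
  obtain ⟨B, hB⟩ := exists_bicentralForest_of_isTreeOfOrderDiam hG
  have hnil : B.pathLengths = 0 := Multiset.eq_zero_of_forall_notMem fun k hk => by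
    have := (B.mem_pathLengths_bounds hk).1
    have := Multiset.le_sum_of_mem hk
    lia
  have htops : B.tops = ∅ := Finset.val_eq_zero.1 (Multiset.map_eq_zero.1 hnil)
  exact B.nonempty_iso_spider_of_tops hG.1 hr (by simp [htops]) (L := []) hnil

theorem pathGraph_isUniqueExtremizer {r : ℕ} (hr : 1 ≤ r) :
    IsUniqueExtremizer (2 * r + 2) (2 * r + 1) (pathGraph (2 * r + 2)) := by
  have hpath : IsTreeOfOrderDiam (2 * r + 2) (2 * r + 1) (pathGraph (2 * r + 2)) :=
    ⟨pathGraph_isTree _, Fintype.card_fin _, pathGraph_diam _⟩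
  obtain ⟨e⟩ := nonempty_iso_spider_of_order_eq hr hpath
  exact isUniqueExtremizer_of_forall_isoOrLambda2LT hpath fun U _ G hG =>
    .inl ((nonempty_iso_spider_of_order_eq hr hG).map fun e' => e'.trans e.symm)

end Path

section LargeOrder

open Multiset

variable {lam : ℝ} {r s q t a b e : ℕ}

theorem sum_response_evenParts (ht : t < q) :
    ((evenParts (q * e + t) q).map (response lam)).sum =
      t * response lam (e + 1) + (q - t) * response lam e := by
  obtain ⟨hdiv, hmod⟩ := (Nat.div_mod_unique (by lia)).2 ⟨add_comm t (q * e), ht⟩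
  rw [evenParts, hdiv, hmod]
  simp [Nat.cast_sub ht.le]

/-- Passing from `q` to `q + 1` parts changes the total response by an amount independent of `q`. -/
theorem sum_response_evenParts_sub_succ (htb : t + b = a + 1) (hb : 0 < b) (haq : a + 1 ≤ q) :
    ((evenParts (q * (a + 1) + t) q).map (response lam)).sum -
        ((evenParts (q * (a + 1) + t) (q + 1)).map (response lam)).sum =
      t * response lam (a + 2) + (b - 1 - t) * response lam (a + 1) - b * response lam a := by
  obtain ⟨m, rfl⟩ := Nat.exists_eq_add_of_le haq
  have hM : (a + 1 + m) * (a + 1) + t = (a + 1 + m + 1) * a + (m + 1 + t) := by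
    ring
  rw [sum_response_evenParts (by lia), hM, sum_response_evenParts (by lia)]
  have hb : (b : ℝ) = a + 1 - t := eq_sub_of_add_eq' (by exact_mod_cast htb)
  rw [hb]
  push_cast
  ring

theorem quadratic_eq_zero_of_sub_eq_zero (h0 : 0 < lam) (hlam : lam * r < 1) (har : a + 2 ≤ r)
    (htb : t + b = a + 1)
    (h : t * response lam (a + 2) + (b - 1 - t) * response lam (a + 1) - b * response lam a = 0) :
    -1 + 3 * (a + 1) * lam - (2 * (a + 1) ^ 2 + a - 2 * t) * lam ^ 2 = 0 := by
  have hp : ∀ k ≤ r, response lam k * (1 - lam * k) = lam := fun k hk =>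
    div_mul_cancel₀ _ (one_sub_mul_pos h0 hlam hk).ne'
  have h₀ := hp a (by lia)
  have h₁ := hp (a + 1) (by lia)
  have h₂ := hp (a + 2) har
  have hb : (b : ℝ) = a + 1 - t := eq_sub_of_add_eq' (by exact_mod_cast htb)
  rw [hb] at h
  push_cast at h₀ h₁ h₂
  have hmul : lam * (-1 + 3 * (a + 1) * lam - (2 * (a + 1) ^ 2 + a - 2 * t) * lam ^ 2) = 0 := by
    linear_combination (1 - lam * a) * (1 - lam * (a + 1)) * (1 - lam * (a + 2)) * h
      - t * (1 - lam * a) * (1 - lam * (a + 1)) * h₂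
      + (2 * t - a) * (1 - lam * a) * (1 - lam * (a + 2)) * h₁
      + (a + 1 - t) * (1 - lam * (a + 1)) * (1 - lam * (a + 2)) * h₀
  exact (mul_eq_zero.1 hmul).resolve_left h0.ne'

theorem finite_setOf_quadratic_eq_zero (x y : ℝ) :
    {z : ℝ | -1 + x * z - y * z ^ 2 = 0}.Finite := by
  let P : Polynomial ℝ := .C (-1) + .C x * .X - .C y * .X ^ 2
  have hP : P ≠ 0 := fun h => by
    have := congrArg (Polynomial.eval 0) h
    simp [P] at this
  refine (Polynomial.finite_setOfPred_isRoot hP).subset fun z hz => ?_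
  simpa [P] using hz

theorem card_le_of_secular_eq_one (hlam : lam * r < 1) (hlam' : 1 < lam * (r + 1)) {p : Multiset ℕ}
    (hp : ∀ k ∈ p, k ≤ r) (h : secular lam r p = 1) :
    (p.card : ℝ) ≤ 1 / ((response lam r - 1) * lam) := by
  have h0 := pos_of_one_lt_mul_add_one hlam'
  have hres := sub_pos.2 (one_lt_response hlam hlam')
  have hsum : p.card • lam ≤ (p.map (response lam)).sum := by
    rw [← card_map (response lam) p]
    refine card_nsmul_le_sum fun y hy => ?_
    obtain ⟨k, hk, rfl⟩ := mem_map.1 hy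
    refine (le_div_iff₀ (one_sub_mul_pos h0 hlam (hp k hk))).2 (mul_le_of_le_one_right h0.le ?_)
    exact sub_le_self _ (by positivity)
  rw [le_div_iff₀ (mul_pos hres h0)]
  calc p.card * ((response lam r - 1) * lam) = (response lam r - 1) * p.card • lam := by
        rw [nsmul_eq_mul]
        ring
    _ ≤ (response lam r - 1) * (response lam r - 1 + (p.map (response lam)).sum) :=
        mul_le_mul_of_nonneg_left (by linarith) hres.le
    _ = 1 := h

theorem mem_evenLengths_mul_add_bounds (har : a + 2 ≤ r) (haq : a + 1 ≤ q) (ht : 0 < t)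
    (hta : t ≤ a) :
    (∀ k ∈ evenLengths (q * (a + 1) + t) q, 1 ≤ k ∧ k ≤ r) ∧
      ∀ k ∈ evenLengths (q * (a + 1) + t) (q + 1), 1 ≤ k ∧ k ≤ r := by
  have hqr := Nat.mul_le_mul_left q har
  exact ⟨mem_evenLengths_bounds (by lia) (by lia) (by lia),
    mem_evenLengths_bounds (by lia) (by lia) (by lia)⟩

theorem quadratic_eq_zero_of_secular_eq (hlam : lam * r < 1) (hlam' : 1 < lam * (r + 1))
    (har : a + 2 ≤ r) (haq : a + 1 ≤ q) (hta : t ≤ a)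
    (h : secular lam r (evenParts (q * (a + 1) + t) q) =
      secular lam r (evenParts (q * (a + 1) + t) (q + 1))) :
    -1 + 3 * (a + 1) * lam - (2 * (a + 1) ^ 2 + a - 2 * t) * lam ^ 2 = 0 := by
  obtain ⟨b, hb⟩ := Nat.exists_eq_add_of_le (hta.trans a.le_succ)
  have hsum := add_left_cancel
    (mul_left_cancel₀ (sub_pos.2 (one_lt_response hlam hlam')).ne' h)
  exact quadratic_eq_zero_of_sub_eq_zero (pos_of_one_lt_mul_add_one hlam') hlam har hb.symm <|
    (sum_response_evenParts_sub_succ hb.symm (by lia) haq).symm.trans (sub_eq_zero.2 hsum)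

/-- A common value of `λ₂` is a root of one of finitely many quadratic polynomials, while for each
of these roots the number of branches is bounded. -/
theorem exists_forall_steklovLambda2_evenSeesaw_ne (har : 2 * a + 1 ≤ r) :
    ∃ N, ∀ q t, N ≤ q → a + 1 ≤ q → 0 < t → t ≤ a →
      steklovLambda2 (evenSeesaw r (q * (a + 1) + t) q) ≠
        steklovLambda2 (evenSeesaw r (q * (a + 1) + t) (q + 1)) := by
  have hfin : (⋃ t ∈ Finset.range (a + 1), {x : ℝ | -1 + 3 * ((a : ℝ) + 1) * x -
      (2 * ((a : ℝ) + 1) ^ 2 + a - 2 * t) * x ^ 2 = 0}).Finite :=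
    Set.Finite.biUnion (Finset.finite_toSet _) fun t _ => finite_setOf_quadratic_eq_zero _ _
  obtain ⟨K, hK⟩ := (hfin.image fun x => 1 / ((response x r - 1) * x)).bddAbove
  obtain ⟨N, hN⟩ := exists_nat_gt K
  refine ⟨N, fun q t hNq haq ht hta heq => ?_⟩
  obtain ⟨hL, hL'⟩ := mem_evenLengths_mul_add_bounds (by lia : a + 2 ≤ r) haq ht hta
  obtain ⟨hlam, hlam', hsec⟩ := steklovLambda2_spider (by lia) hL
  obtain ⟨-, -, hsec'⟩ := steklovLambda2_spider (by lia) hL'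
  rw [← show steklovLambda2 (spider ((r + 1) :: r :: evenLengths _ _)) =
    steklovLambda2 (spider ((r + 1) :: r :: evenLengths _ _)) from heq] at hsec'
  have hroot := quadratic_eq_zero_of_secular_eq hlam hlam' (by lia) haq hta (hsec.trans hsec'.symm)
  have hle := hK (Set.mem_image_of_mem _ (Set.mem_biUnion (by simpa using hta) hroot))
  have hcard := card_le_of_secular_eq_one hlam hlam' (fun k hk => (hL k hk).2) hsec
  rw [coe_evenLengths, card_evenParts (by lia)] at hcard
  have : (N : ℝ) ≤ q := by exact_mod_cast hNq
  linarith

theorem ceilDiv_mul_add (ht : 0 < t) (hts : t ≤ s) : (q * s + t) ⌈/⌉ s = q + 1 := by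
  rw [Nat.ceilDiv_eq_add_pred_div]
  exact Nat.div_eq_of_lt_le (by rw [add_one_mul]; lia) (by rw [add_one_mul, add_one_mul]; lia)

theorem exists_forall_exists_isUniqueExtremizer (hr : 1 ≤ r) :
    ∃ N, ∀ M ≥ N, ∃ q, IsUniqueExtremizer (2 * r + 2 + M) (2 * r + 1) (evenSeesaw r M q) := by
  obtain ⟨a, ha⟩ : ∃ a, a + 1 = (r + 1) / 2 := ⟨(r - 1) / 2, by lia⟩
  obtain ⟨N, hN⟩ := exists_forall_steklovLambda2_evenSeesaw_ne (r := r) (a := a) (by lia)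
  refine ⟨(N + (a + 1)) * (a + 1), fun M hM => ?_⟩
  have hq : N + (a + 1) ≤ M / (a + 1) := (Nat.le_div_iff_mul_le a.succ_pos).2 hM
  have hdom := isDominatingPair_evenSeesaw (M := M) hr ha (by lia)
  have hdiv := Nat.div_add_mod' M (a + 1)
  have hmod := Nat.mod_lt M a.succ_pos
  rw [max_eq_right (by lia)] at hdom
  generalize M / (a + 1) = q at hq hdom hdiv
  generalize M % (a + 1) = t at hmod hdiv
  subst hdiv
  rcases Nat.eq_zero_or_pos t with rfl | ht
  · obtain ⟨m, rfl⟩ := Nat.exists_eq_add_one_of_ne_zero (by lia : q ≠ 0)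
    have hceil := ceilDiv_mul_add (q := m) a.succ_pos le_rfl
    rw [← add_one_mul] at hceil
    rw [add_zero, hceil] at hdom
    exact ⟨_, hdom.isUniqueExtremizer_of_self⟩
  · rw [ceilDiv_mul_add ht hmod.le] at hdom
    rcases (hN q t (by lia) (by lia) ht (by lia)).lt_or_gt with hlt | hlt
    · exact ⟨_, hdom.symm.isUniqueExtremizer_of_lt hlt⟩
    · exact ⟨_, hdom.isUniqueExtremizer_of_lt hlt⟩

theorem IsUniqueExtremizer.exists_fin {V : Type} [Fintype V] {G : SimpleGraph V} {n D : ℕ}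
    (h : IsUniqueExtremizer n D G) : ∃ H : SimpleGraph (Fin n), IsUniqueExtremizer n D H := by
  let e := (Fintype.equivFinOfCardEq h.1.1.2.1).symm
  exact ⟨G.comap e, h.of_iso (SimpleGraph.Iso.comap e G)⟩

end LargeOrder

theorem ceil_natCast_div {M s : ℕ} (hs : 0 < s) : ⌈(M : ℚ) / s⌉₊ = M ⌈/⌉ s :=
  eq_of_forall_ge_iff fun k => by
    rw [Nat.ceil_le, ceilDiv_le_iff_le_mul hs, div_le_iff₀ (by exact_mod_cast hs), mul_comm]
    exact_mod_cast Iff.rfl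

theorem ceil_natCast_div_two (r : ℕ) : ⌈(r : ℚ) / 2⌉₊ = (r + 1) / 2 :=
  (ceil_natCast_div two_pos).trans (Nat.ceilDiv_eq_add_pred_div r 2)

theorem theorem1p2 (r : ℕ) (hr : 1 ≤ r) :
    (∀ n M : ℕ, 2 * r + 2 ≤ n → M = n - 2 * r - 2 →
      (M = 0 → IsUniqueExtremizer n (2 * r + 1) (SimpleGraph.pathGraph (2 * r + 2))) ∧
      (1 ≤ M → ∀ s qm qp cm tm cp tp : ℕ,
        s = ⌈(r : ℚ) / 2⌉₊ →
        qm = max 1 ⌊(M : ℚ) / (s : ℚ)⌋₊ →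
        qp = ⌈(M : ℚ) / (s : ℚ)⌉₊ →
        M = qm * cm + tm → tm < qm →
        M = qp * cp + tp → tp < qp →
        -- the maximal value
        IsGreatest
          {x : ℝ | ∃ (V : Type) (_ : Fintype V) (G : SimpleGraph V),
            IsTreeOfOrderDiam n (2 * r + 1) G ∧ steklovLambda2 G = x}
          (max (steklovLambda2 (almostSeesaw r (qm + 2) cm tm))
            (steklovLambda2 (almostSeesaw r (qp + 2) cp tp))) ∧
        -- both candidates are trees of order `n` and diameter `2 * r + 1`
        IsTreeOfOrderDiam n (2 * r + 1) (almostSeesaw r (qm + 2) cm tm) ∧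
        IsTreeOfOrderDiam n (2 * r + 1) (almostSeesaw r (qp + 2) cp tp) ∧
        -- every maximizer is one of the two candidates
        (∀ (V : Type) [Fintype V] (G : SimpleGraph V), IsExtremizer n (2 * r + 1) G →
          Nonempty (G ≃g almostSeesaw r (qm + 2) cm tm) ∨
          Nonempty (G ≃g almostSeesaw r (qp + 2) cp tp)) ∧
        -- uniqueness when the two values differ
        (steklovLambda2 (almostSeesaw r (qp + 2) cp tp) <
            steklovLambda2 (almostSeesaw r (qm + 2) cm tm) →
          IsUniqueExtremizer n (2 * r + 1) (almostSeesaw r (qm + 2) cm tm)) ∧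
        (steklovLambda2 (almostSeesaw r (qm + 2) cm tm) <
            steklovLambda2 (almostSeesaw r (qp + 2) cp tp) →
          IsUniqueExtremizer n (2 * r + 1) (almostSeesaw r (qp + 2) cp tp)))) ∧
    -- uniqueness for all sufficiently large orders
    ∃ N : ℕ, ∀ n : ℕ, N ≤ n →
      ∃ H : SimpleGraph (Fin n), IsUniqueExtremizer n (2 * r + 1) H := by
  refine ⟨fun n M hn hM => ⟨fun hM0 => ?_, ?_⟩, ?_⟩
  · obtain rfl : n = 2 * r + 2 := by lia
    exact pathGraph_isUniqueExtremizer hr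
  · intro hM1 s qm qp cm tm cp tp hs hqm hqp hm htm hp htp
    obtain rfl : n = 2 * r + 2 + M := by lia
    rw [ceil_natCast_div_two] at hs
    rw [Nat.floor_div_eq_div] at hqm
    rw [ceil_natCast_div (by lia)] at hqp
    obtain ⟨rfl, rfl⟩ := (Nat.div_mod_unique (by lia)).2 ⟨(add_comm _ _).trans hm.symm, htm⟩
    obtain ⟨rfl, rfl⟩ := (Nat.div_mod_unique (by lia)).2 ⟨(add_comm _ _).trans hp.symm, htp⟩
    subst hqm hqp
    have hdom := isDominatingPair_evenSeesaw hr hs hM1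
    exact ⟨hdom.isGreatest, hdom.left, hdom.right, fun V _ G hG => hdom.nonempty_iso hG,
      hdom.isUniqueExtremizer_of_lt, hdom.symm.isUniqueExtremizer_of_lt⟩
  · obtain ⟨N, hN⟩ := exists_forall_exists_isUniqueExtremizer hr
    refine ⟨2 * r + 2 + N, fun n hn => ?_⟩
    obtain ⟨M, rfl⟩ := Nat.exists_eq_add_of_le ((Nat.le_add_right _ N).trans hn)
    obtain ⟨q, hq⟩ := hN M (by lia)
    exact hq.exists_fin
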